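/- Theorem 3.2. Let $H$ be a separable infinite-dimensional complex Hilbert space; "ideal" means two-sided ideal of the algebra $B(H)$ of bounded operators. Let $c_o^*$ (resp. $\ell_1^*$) be the set of nonincreasing sequences $\xi=\langle \xi_n\rangle_{n\ge1}$ of nonnegative reals that converge to $0$ (resp. are summable), and for $\eta\in\ell_1^*$ let $\eta_{a_\infty}:=\big\langle \frac1n\sum_{j=n+1}^\infty \eta_j\big\rangle_{n\ge1}$. For an ideal $I$ let $\Sigma(I)\subset c_o^*$ be its characteristic set, i.e. the set of the $s$-number sequences of the compact operators in $I$, and let $\mathcal L_1$ be the trace class, so $\Sigma(\mathcal L_1)=\ell_1^*$. Let $I_{a_\infty}$ be the ideal with $$\Sigma(I_{a_\infty})=\{\xi\in c_o^* \mid \xi=O(\eta_{a_\infty})\text{ for some }\eta\in\Sigma(I\cap\mathcal L_1)\},$$ and, for $I\neq\{0\}$, let ${}_{a_\infty}I$ be the ideal with $$\Sigma({}_{a_\infty}I)=\{\xi\in\ell_1^*\mid \xi_{a_\infty}\in\Sigma(I)\};$$ put ${}_{a_\infty}\{0\}:=\{0\}$. The am-$\infty$ closure of $I$ is $I^{-\infty}:={}_{a_\infty}(I_{a_\infty})$,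 and $I$ is called am-$\infty$ closed if $I=I^{-\infty}$. Then for all ideals $I,J$ of $B(H)$, $$(I+J)^{-\infty}=I^{-\infty}+J^{-\infty}.$$ In particular, the sum of two am-$\infty$ closed ideals is am-$\infty$ closed. -/

import Mathlib

noncomputable section

namespace OperatorIdeal

/-- The set `c_o^*` of real sequences decreasing (in the weak sense) to `0`.  Sequences are indexed
by `ℕ` starting at `0`, so that `ξ k` is the entry written `ξ_{k+1}` in one-based notation. -/
def cZeroStar : Set (ℕ → ℝ) :=
  {ξ | Antitone ξ ∧ Filter.Tendsto ξ Filter.atTop (nhds 0)}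

/-- The set `ℓ_1^*` of nonincreasing nonnegative summable sequences. -/
def lOneStar : Set (ℕ → ℝ) :=
  {ξ | ξ ∈ cZeroStar ∧ Summable ξ}

/-- The arithmetic mean at infinity of a (summable) sequence: in one-based notation the `n`-th entry
is `(1 / n) * ∑_{j ≥ n + 1} η_j`; here `n = k + 1`. -/
def amInfSeq (η : ℕ → ℝ) : ℕ → ℝ :=
  fun k => (1 / ((k : ℝ) + 1)) * ∑' j : ℕ, η (k + 1 + j)

variable {H : Type*} [NormedAddCommGroup H] [InnerProductSpace ℂ H]

/-- The sequence of `s`-numbers (singular numbers) of a bounded operator: the `k`-th entry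
(`k = 0, 1, 2, …`) is the distance in operator norm from `X` to the operators of rank at most `k`.
For a compact operator this is the nonincreasing sequence of the eigenvalues of `|X|`, repeated
according to multiplicity (followed by zeros if `X` has finite rank). -/
def sNumbers (X : H →L[ℂ] H) : ℕ → ℝ :=
  fun k => sInf {r : ℝ | ∃ F : H →L[ℂ] H,
    LinearMap.rank (F : H →ₗ[ℂ] H) ≤ (k : Cardinal) ∧ r = ‖X - F‖}

/-- The characteristic set `Σ(I)` of a two-sided ideal `I` of bounded operators: all sequences of
`s`-numbers of the compact operators in `I`.  (On a separable infinite dimensional Hilbert space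
compactness is automatic unless `I` is the whole algebra.) -/
def charSet (I : TwoSidedIdeal (H →L[ℂ] H)) : Set (ℕ → ℝ) :=
  {ξ | ∃ X : H →L[ℂ] H, X ∈ I ∧ IsCompactOperator X ∧ sNumbers X = ξ}

variable (H) in
/-- The two-sided ideal attached to a set `S` of sequences by the Calkin correspondence: the ideal
generated by the compact operators whose sequence of `s`-numbers lies in `S`.  When `S` is a
characteristic set this is the ideal with characteristic set `S`. -/
def idealOf (S : Set (ℕ → ℝ)) : TwoSidedIdeal (H →L[ℂ] H) :=
  TwoSidedIdeal.span {X | IsCompactOperator X ∧ sNumbers X ∈ S}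

variable (H) in
/-- The trace class ideal `𝓛₁`, the ideal with characteristic set `ℓ_1^*`. -/
def traceClass : TwoSidedIdeal (H →L[ℂ] H) :=
  idealOf H lOneStar

/-- The arithmetic mean at infinity `I_{a_∞}` of an ideal: the ideal with characteristic set
`{ξ ∈ c_o^* | ξ = O(η_{a_∞}) for some η ∈ Σ(I ∩ 𝓛₁)}`. -/
def amInf (I : TwoSidedIdeal (H →L[ℂ] H)) : TwoSidedIdeal (H →L[ℂ] H) :=
  idealOf H {ξ | ξ ∈ cZeroStar ∧
    ∃ η ∈ charSet (I ⊓ traceClass H), ∃ M : ℝ, ∀ k, ξ k ≤ M * amInfSeq η k}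

open Classical in
/-- The pre-arithmetic mean at infinity `_{a_∞}I` of an ideal: for `I ≠ {0}` the ideal with
characteristic set `{ξ ∈ ℓ_1^* | ξ_{a_∞} ∈ Σ(I)}`.  For `I = {0}` this set, which is
`{(t, 0, 0, …) | t ≥ 0}`, is not a characteristic set; there `_{a_∞}{0} = {0}` by convention. -/
def preAmInf (I : TwoSidedIdeal (H →L[ℂ] H)) : TwoSidedIdeal (H →L[ℂ] H) :=
  if I = ⊥ then ⊥ else idealOf H {ξ | ξ ∈ lOneStar ∧ amInfSeq ξ ∈ charSet I}

/-- The am-`∞` closure `I^{-∞} = _{a_∞}(I_{a_∞})` of an ideal. -/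
def amInfClosure (I : TwoSidedIdeal (H →L[ℂ] H)) : TwoSidedIdeal (H →L[ℂ] H) :=
  preAmInf (amInf I)

/-- An ideal is am-`∞` closed if it equals its am-`∞` closure. -/
def IsAmInfClosed (I : TwoSidedIdeal (H →L[ℂ] H)) : Prop :=
  I = amInfClosure I

end OperatorIdeal

end

/-! The closure is monotone in the ideal, so the content is `(I + J)^{-∞} ⊆ I^{-∞} + J^{-∞}`. By the
Calkin correspondence (`mem_charSet_iff`), membership of a compact operator in an ideal depends only
on its singular numbers, and the question becomes one about sequences. A generator of the left side
has a summable singular sequence `ξ` with `ξ_{a_∞} ≤ M η_{a_∞}` and `η ∈ Σ((I + J) ∩ 𝓛₁)`. Two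
decompositions finish the proof.

The first splits `η`. Conjugating a sum of positive parts shows that positive operators of `(I + J)
∩ K` split into `I ∩ K` and `J ∩ K` (`exists_nonneg_add_of_mem_sup`), so `η ≤ α + β` with `α ∈ Σ(I ∩
𝓛₁)` and `β ∈ Σ(J ∩ 𝓛₁)`.

The second splits `ξ` (`exists_le_add_of_amInfSeq_le`). The tails of `ξ` are at most `M` times the
sum of the tails of `α` and `β`, hence at each index at most `2M` times the larger one. Sort the
indices by which tail is larger, and let `ξ₁`, `ξ₂` be the least monotone sequences dominating `ξ`
on the two classes. Then `ξ ≤ ξ₁ + ξ₂`. The plateaus of an envelope cost only a factor 2 and a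
halving of the index (`mul_add_tail_le`), both absorbed by the ampliation `n ↦ α (n / 2)`, under
which characteristic sets are stable. So `ξ₁ ∈ Σ(I^{-∞})` and `ξ₂ ∈ Σ(J^{-∞})`. -/

noncomputable section

namespace OperatorIdeal

open scoped InnerProductSpace

/-! ### Operators diagonal with respect to two orthonormal sequences. -/

section Diagonal

variable {H : Type*} [NormedAddCommGroup H] [InnerProductSpace ℂ H]

/-- Douglas factorization. -/
theorem exists_eq_mul_of_norm_apply_le [CompleteSpace H] {X Y : H →L[ℂ] H}
    (h : ∀ v, ‖X v‖ ≤ ‖Y v‖) : ∃ C : H →L[ℂ] H, X = C * Y := by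
  let K : Submodule ℂ H := (LinearMap.range (Y : H →ₗ[ℂ] H)).topologicalClosure
  have hmem : ∀ v, Y v ∈ K := fun v => Submodule.le_topologicalClosure _ ⟨v, rfl⟩
  let e : H →ₗ[ℂ] K := (Y : H →ₗ[ℂ] H).codRestrict K hmem
  have hd : DenseRange e := by
    intro x
    rw [closure_subtype]
    have hx : (x : H) ∈ closure (LinearMap.range (Y : H →ₗ[ℂ] H) : Set H) := x.2
    refine closure_mono ?_ hx
    rintro _ ⟨v, rfl⟩
    exact ⟨e v, ⟨v, rfl⟩, rfl⟩
  have : CompleteSpace K := (Submodule.isClosed_topologicalClosure _).completeSpace_coe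
  let G : K →L[ℂ] H := (X : H →ₗ[ℂ] H).extendOfNorm e
  refine ⟨G ∘L K.orthogonalProjectionOnto, ?_⟩
  ext v
  have h1 : K.orthogonalProjectionOnto (Y v) = e v :=
    Submodule.orthogonalProjectionOnto_mem_subspace_eq_self (e v)
  have h2 : G (e v) = X v :=
    LinearMap.extendOfNorm_eq hd ⟨1, fun x => by simpa [e] using h x⟩ v
  simp [h1, h2]

theorem mem_of_norm_apply_le [CompleteSpace H] {I : TwoSidedIdeal (H →L[ℂ] H)} {X Y : H →L[ℂ] H}
    (h : ∀ v, ‖X v‖ ≤ ‖Y v‖) (hY : Y ∈ I) : X ∈ I := by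
  obtain ⟨C, rfl⟩ := exists_eq_mul_of_norm_apply_le h
  exact I.mul_mem_left _ _ hY

theorem smul_mem {I : TwoSidedIdeal (H →L[ℂ] H)} {X : H →L[ℂ] H} (c : ℂ) (hX : X ∈ I) :
    c • X ∈ I := by
  have : c • X = (c • (1 : H →L[ℂ] H)) * X := by simp
  rw [this]; exact I.mul_mem_left _ _ hX

/-- A real sequence with bounded range. -/
def IsBddSeq (ξ : ℕ → ℝ) : Prop := ∃ C, ∀ n, |ξ n| ≤ C

theorem summable_smul_orthonormal [CompleteSpace H] {e f : ℕ → H} (he : Orthonormal ℂ e)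
    (hf : Orthonormal ℂ f) {ξ : ℕ → ℝ} (hξ : IsBddSeq ξ) (v : H) :
    Summable fun n => ((ξ n : ℂ) * ⟪e n, v⟫_ℂ) • f n := by
  obtain ⟨C, hC⟩ := hξ
  refine (hf.orthogonalFamily.summable_iff_norm_sq_summable
    (fun n => (ξ n : ℂ) * ⟪e n, v⟫_ℂ)).2 ?_
  refine Summable.of_nonneg_of_le (fun n => by positivity) (fun n => ?_)
    ((he.inner_products_summable (x := v)).mul_left (C ^ 2))
  rw [norm_mul, mul_pow, Complex.norm_real, Real.norm_eq_abs]
  gcongr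
  exact hC n

theorem hasSum_norm_sq_smul_orthonormal [CompleteSpace H] {e f : ℕ → H} (he : Orthonormal ℂ e)
    (hf : Orthonormal ℂ f) {ξ : ℕ → ℝ} (hξ : IsBddSeq ξ) (v : H) :
    HasSum (fun n => ξ n ^ 2 * ‖⟪e n, v⟫_ℂ‖ ^ 2)
      (‖∑' n, ((ξ n : ℂ) * ⟪e n, v⟫_ℂ) • f n‖ ^ 2) := by
  have hs := (summable_smul_orthonormal he hf hξ v).hasSum
  set w := ∑' n, ((ξ n : ℂ) * ⟪e n, v⟫_ℂ) • f n
  have h1 : ∀ m, ⟪f m, w⟫_ℂ = (ξ m : ℂ) * ⟪e m, v⟫_ℂ := by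
    intro m
    have h2 := hs.mapL (innerSL ℂ (f m))
    simp only [innerSL_apply_apply, inner_smul_right, orthonormal_iff_ite.1 hf, mul_ite, mul_one,
      mul_zero] at h2
    simpa using h2.unique (hasSum_single m fun n hn => if_neg hn.symm)
  have h3 := hs.mapL (innerSL ℂ w)
  simp only [innerSL_apply_apply, inner_smul_right] at h3
  have h4 : ∀ n, (ξ n : ℂ) * ⟪e n, v⟫_ℂ * ⟪w, f n⟫_ℂ
      = ((ξ n ^ 2 * ‖⟪e n, v⟫_ℂ‖ ^ 2 : ℝ) : ℂ) := by
    intro n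
    rw [← inner_conj_symm w (f n), h1, Complex.mul_conj, Complex.normSq_eq_norm_sq, norm_mul, mul_pow,
      Complex.norm_real, Real.norm_eq_abs, sq_abs]
  simp only [h4, inner_self_eq_norm_sq_to_K] at h3
  rw [show ((RCLike.ofReal ‖w‖ : ℂ)) ^ 2 = ((‖w‖ ^ 2 : ℝ) : ℂ) by push_cast; rfl] at h3
  exact Complex.hasSum_ofReal.1 h3

theorem norm_tsum_smul_orthonormal_le [CompleteSpace H] {e f : ℕ → H} (he : Orthonormal ℂ e)
    (hf : Orthonormal ℂ f) {ξ : ℕ → ℝ} (hξ : IsBddSeq ξ) {C : ℝ} (hC : ∀ n, |ξ n| ≤ C) (v : H) :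
    ‖∑' n, ((ξ n : ℂ) * ⟪e n, v⟫_ℂ) • f n‖ ≤ C * ‖v‖ := by
  have hC0 : 0 ≤ C := (abs_nonneg _).trans (hC 0)
  refine abs_le_of_sq_le_sq' ?_ (by positivity) |>.2
  rw [mul_pow]
  refine (hasSum_le (fun n => ?_) (hasSum_norm_sq_smul_orthonormal he hf hξ v)
    ((he.inner_products_summable (x := v)).hasSum.mul_left (C ^ 2))).trans ?_
  · rw [← sq_abs (ξ n)]; gcongr; exact hC n
  · gcongr; exact he.tsum_inner_products_le v

theorem Orthonormal.mul_two {e : ℕ → H} (he : Orthonormal ℂ e) : Orthonormal ℂ fun n => e (2 * n) :=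
  he.comp (fun n => 2 * n) (fun a b h => by simpa using h)

theorem Orthonormal.mul_two_add_one {e : ℕ → H} (he : Orthonormal ℂ e) :
    Orthonormal ℂ fun n => e (2 * n + 1) :=
  he.comp (fun n => 2 * n + 1) (fun a b h => by simpa using h)

/-- The operator `v ↦ ∑ ξ n ⟪e n, v⟫ f n` for orthonormal sequences `e`, `f` and bounded `ξ`. -/
def diagOp [CompleteSpace H] {e f : ℕ → H} (he : Orthonormal ℂ e) (hf : Orthonormal ℂ f)
    {ξ : ℕ → ℝ} (hξ : IsBddSeq ξ) : H →L[ℂ] H :=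
  LinearMap.mkContinuousOfExistsBound
    { toFun := fun v => ∑' n, ((ξ n : ℂ) * ⟪e n, v⟫_ℂ) • f n
      map_add' := fun v w => by
        rw [← (summable_smul_orthonormal he hf hξ v).tsum_add
          (summable_smul_orthonormal he hf hξ w)]
        simp only [inner_add_right, mul_add, add_smul]
      map_smul' := fun c v => by
        rw [RingHom.id_apply, ← (summable_smul_orthonormal he hf hξ v).tsum_const_smul c]
        congr 1; ext n
        rw [inner_smul_right, smul_smul]; congr 1; ring }
    (by
      obtain ⟨C, hC⟩ := id hξ
      exact ⟨C, norm_tsum_smul_orthonormal_le he hf hξ hC⟩)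

section diagOp

variable [CompleteSpace H] {d e f : ℕ → H} (hd : Orthonormal ℂ d) (he : Orthonormal ℂ e)
  (hf : Orthonormal ℂ f) {ξ η : ℕ → ℝ} (hξ : IsBddSeq ξ) (hη : IsBddSeq η)

theorem hasSum_diagOp (v : H) :
    HasSum (fun n => ((ξ n : ℂ) * ⟪e n, v⟫_ℂ) • f n) (diagOp he hf hξ v) :=
  (summable_smul_orthonormal he hf hξ v).hasSum

theorem hasSum_norm_sq_diagOp (v : H) :
    HasSum (fun n => ξ n ^ 2 * ‖⟪e n, v⟫_ℂ‖ ^ 2) (‖diagOp he hf hξ v‖ ^ 2) :=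
  hasSum_norm_sq_smul_orthonormal he hf hξ v

theorem norm_diagOp_apply_le {C : ℝ} (hC : ∀ n, |ξ n| ≤ C) (v : H) :
    ‖diagOp he hf hξ v‖ ≤ C * ‖v‖ :=
  norm_tsum_smul_orthonormal_le he hf hξ hC v

theorem inner_diagOp (m : ℕ) (v : H) :
    ⟪f m, diagOp he hf hξ v⟫_ℂ = (ξ m : ℂ) * ⟪e m, v⟫_ℂ := by
  have h2 := (hasSum_diagOp he hf hξ v).mapL (innerSL ℂ (f m))
  simp only [innerSL_apply_apply, inner_smul_right, orthonormal_iff_ite.1 hf, mul_ite, mul_one,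
    mul_zero] at h2
  simpa using h2.unique (hasSum_single m fun n hn => if_neg hn.symm)

theorem diagOp_apply_self (m : ℕ) : diagOp he hf hξ (e m) = (ξ m : ℂ) • f m := by
  refine (hasSum_diagOp he hf hξ (e m)).unique ?_
  convert hasSum_ite_eq m ((ξ m : ℂ) • f m) using 2 with n
  rw [orthonormal_iff_ite.1 he n m]
  by_cases hmn : n = m
  · subst hmn; simp
  · simp [hmn]

theorem IsBddSeq.mul {ξ η : ℕ → ℝ} (hξ : IsBddSeq ξ) (hη : IsBddSeq η) :
    IsBddSeq fun n => ξ n * η n := by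
  obtain ⟨C, hC⟩ := hξ
  obtain ⟨D, hD⟩ := hη
  refine ⟨C * D, fun n => ?_⟩
  rw [abs_mul]
  exact mul_le_mul (hC n) (hD n) (abs_nonneg _) ((abs_nonneg _).trans (hC n))

theorem IsBddSeq.add {ξ η : ℕ → ℝ} (hξ : IsBddSeq ξ) (hη : IsBddSeq η) :
    IsBddSeq fun n => ξ n + η n := by
  obtain ⟨C, hC⟩ := hξ
  obtain ⟨D, hD⟩ := hη
  exact ⟨C + D, fun n => (abs_add_le _ _).trans (add_le_add (hC n) (hD n))⟩

theorem IsBddSeq.comp {ξ : ℕ → ℝ} (hξ : IsBddSeq ξ) (φ : ℕ → ℕ) : IsBddSeq fun n => ξ (φ n) := by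
  obtain ⟨C, hC⟩ := hξ
  exact ⟨C, fun n => hC _⟩

theorem isBddSeq_const (c : ℝ) : IsBddSeq fun _ => c := ⟨|c|, fun _ => le_rfl⟩

theorem diagOp_mul_diagOp :
    diagOp he hf hη * diagOp hd he hξ = diagOp hd hf (hη.mul hξ) := by
  refine ContinuousLinearMap.ext fun v => ?_
  refine (hasSum_diagOp he hf hη _).unique ?_
  convert hasSum_diagOp hd hf (hη.mul hξ) v using 2 with n
  refine congrArg (· • f n) ?_
  change (η n : ℂ) * ⟪e n, diagOp hd he hξ v⟫_ℂ = _
  rw [inner_diagOp]; push_cast; ring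

theorem diagOp_add : diagOp he hf hξ + diagOp he hf hη = diagOp he hf (hξ.add hη) := by
  refine ContinuousLinearMap.ext fun v => ?_
  refine ((hasSum_diagOp he hf hξ v).add (hasSum_diagOp he hf hη v)).unique ?_
  convert hasSum_diagOp he hf (hξ.add hη) v using 2 with n
  rw [← add_smul]; push_cast; congr 1; ring

/-- Even and odd indices each carry a copy of `ξ`. This is why every ideal is stable under
ampliation of its sequences. -/
theorem diagOp_half : diagOp he hf (hξ.comp fun n => n / 2) =
    diagOp (Orthonormal.mul_two he) (Orthonormal.mul_two hf) hξ +
      diagOp (Orthonormal.mul_two_add_one he) (Orthonormal.mul_two_add_one hf) hξ := by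
  refine ContinuousLinearMap.ext fun v => ?_
  refine (hasSum_diagOp he hf (hξ.comp fun n => n / 2) v).unique ?_
  have h1 := hasSum_diagOp (Orthonormal.mul_two he) (Orthonormal.mul_two hf) hξ v
  have h2 := hasSum_diagOp (Orthonormal.mul_two_add_one he) (Orthonormal.mul_two_add_one hf) hξ v
  refine HasSum.even_add_odd (f := fun n => ((ξ (n / 2) : ℂ) * ⟪e n, v⟫_ℂ) • f n) ?_ ?_
  · simpa using! h1
  · have h3 : ∀ k, (2 * k + 1) / 2 = k := fun k => by omega
    simpa [h3] using! h2

variable {I : TwoSidedIdeal (H →L[ℂ] H)}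

/-- Membership in an ideal does not depend on the orthonormal sequences. -/
theorem diagOp_mem_of_mem {e' f' : ℕ → H} (he' : Orthonormal ℂ e') (hf' : Orthonormal ℂ f')
    (h : diagOp he hf hξ ∈ I) : diagOp he' hf' hξ ∈ I := by
  -- With constant weight 1, `diagOp` is a partial isometry carrying one orthonormal sequence to
  -- another.
  have h1 := I.mul_mem_left (diagOp hf hf' (isBddSeq_const 1)) _
    (I.mul_mem_right _ (diagOp he' he (isBddSeq_const 1)) h)
  rw [diagOp_mul_diagOp, diagOp_mul_diagOp] at h1
  simpa using h1

theorem diagOp_half_mem (h : diagOp he hf hξ ∈ I) :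
    diagOp he hf (hξ.comp fun n => n / 2) ∈ I := by
  rw [diagOp_half he hf hξ]
  exact I.add_mem (diagOp_mem_of_mem he hf hξ _ _ h) (diagOp_mem_of_mem he hf hξ _ _ h)

theorem diagOp_mem_of_abs_le {C : ℝ} (hle : ∀ n, |ξ n| ≤ C * |η n|) (h : diagOp he hf hη ∈ I) :
    diagOp he hf hξ ∈ I := by
  -- The multiplier is the diagonal of quotients. Where `η n = 0` the quotient is `0` by convention,
  -- which is correct because the bound then forces `ξ n = 0`.
  have hb : IsBddSeq fun n => ξ n / η n := by
    refine ⟨max C 0, fun n => ?_⟩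
    rw [abs_div]
    rcases eq_or_ne (η n) 0 with h0 | h0
    · simp [h0]
    · exact (div_le_iff₀ (abs_pos.2 h0)).2 ((hle n).trans (by gcongr; exact le_max_left _ _))
  have h1 := I.mul_mem_left (diagOp hf hf hb) _ h
  rw [diagOp_mul_diagOp] at h1
  convert h1 using 2
  ext n
  rcases eq_or_ne (η n) 0 with h0 | h0
  · have := hle n
    simp only [h0, abs_zero, mul_zero] at this
    simp [h0, abs_nonpos_iff.1 this]
  · field_simp

end diagOp

end Diagonal

/-! ### Singular numbers and the Schmidt decomposition. -/

section SingularNumbers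

variable {H : Type*} [NormedAddCommGroup H] [InnerProductSpace ℂ H]

section sNumbers

theorem bddBelow_sNumbers_set (X : H →L[ℂ] H) (k : ℕ) : BddBelow {r : ℝ | ∃ F : H →L[ℂ] H,
    LinearMap.rank (F : H →ₗ[ℂ] H) ≤ (k : Cardinal) ∧ r = ‖X - F‖} := by
  refine ⟨0, ?_⟩
  rintro _ ⟨F, -, rfl⟩
  exact norm_nonneg _

theorem sNumbers_le {X F : H →L[ℂ] H} {k : ℕ}
    (hF : LinearMap.rank (F : H →ₗ[ℂ] H) ≤ (k : Cardinal)) : sNumbers X k ≤ ‖X - F‖ :=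
  csInf_le (bddBelow_sNumbers_set X k) ⟨F, hF, rfl⟩

theorem nonempty_sNumbers_set (X : H →L[ℂ] H) (k : ℕ) : {r : ℝ | ∃ F : H →L[ℂ] H,
    LinearMap.rank (F : H →ₗ[ℂ] H) ≤ (k : Cardinal) ∧ r = ‖X - F‖}.Nonempty :=
  ⟨_, 0, by simp [LinearMap.rank_zero], rfl⟩

theorem le_sNumbers {X : H →L[ℂ] H} {k : ℕ} {c : ℝ}
    (h : ∀ F : H →L[ℂ] H, LinearMap.rank (F : H →ₗ[ℂ] H) ≤ (k : Cardinal) → c ≤ ‖X - F‖) :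
    c ≤ sNumbers X k := by
  refine le_csInf (nonempty_sNumbers_set X k) ?_
  rintro _ ⟨F, hF, rfl⟩
  exact h F hF

theorem exists_norm_sub_lt (X : H →L[ℂ] H) (k : ℕ) {ε : ℝ} (hε : 0 < ε) :
    ∃ F : H →L[ℂ] H, LinearMap.rank (F : H →ₗ[ℂ] H) ≤ (k : Cardinal) ∧
      ‖X - F‖ < sNumbers X k + ε := by
  obtain ⟨_, ⟨F, hF, rfl⟩, h⟩ := Real.lt_sInf_add_pos (nonempty_sNumbers_set X k) hε
  exact ⟨F, hF, h⟩

theorem sNumbers_nonneg (X : H →L[ℂ] H) (k : ℕ) : 0 ≤ sNumbers X k :=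
  le_sNumbers fun _ _ => norm_nonneg _

theorem sNumbers_antitone (X : H →L[ℂ] H) : Antitone (sNumbers X) := fun m n h =>
  le_sNumbers fun _ hF => sNumbers_le (hF.trans (by exact_mod_cast h))

theorem sNumbers_add_le (X Y : H →L[ℂ] H) (m n : ℕ) :
    sNumbers (X + Y) (m + n) ≤ sNumbers X m + sNumbers Y n := by
  refine le_of_forall_pos_le_add fun ε hε => ?_
  obtain ⟨F, hF, hF'⟩ := exists_norm_sub_lt X m (half_pos hε)
  obtain ⟨G, hG, hG'⟩ := exists_norm_sub_lt Y n (half_pos hε)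
  have h1 : LinearMap.rank ((F + G : H →L[ℂ] H) : H →ₗ[ℂ] H) ≤ ((m + n : ℕ) : Cardinal) := by
    push_cast
    exact (LinearMap.rank_add_le (F : H →ₗ[ℂ] H) (G : H →ₗ[ℂ] H)).trans (add_le_add hF hG)
  calc sNumbers (X + Y) (m + n) ≤ ‖X + Y - (F + G)‖ := sNumbers_le h1
    _ = ‖(X - F) + (Y - G)‖ := by congr 1; abel
    _ ≤ ‖X - F‖ + ‖Y - G‖ := norm_add_le _ _
    _ ≤ _ := by linarith

theorem sNumbers_mul_left_le (A X : H →L[ℂ] H) (k : ℕ) :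
    sNumbers (A * X) k ≤ ‖A‖ * sNumbers X k := by
  refine le_of_forall_pos_le_add fun ε hε => ?_
  obtain ⟨F, hF, hF'⟩ := exists_norm_sub_lt X k (ε := ε / (‖A‖ + 1)) (by positivity)
  have h1 : LinearMap.rank ((A * F : H →L[ℂ] H) : H →ₗ[ℂ] H) ≤ (k : Cardinal) :=
    (LinearMap.rank_comp_le_right (F : H →ₗ[ℂ] H) (A : H →ₗ[ℂ] H)).trans hF
  calc sNumbers (A * X) k ≤ ‖A * X - A * F‖ := sNumbers_le h1
    _ ≤ ‖A‖ * ‖X - F‖ := by rw [← mul_sub]; exact norm_mul_le _ _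
    _ ≤ ‖A‖ * (sNumbers X k + ε / (‖A‖ + 1)) := by gcongr
    _ = ‖A‖ * sNumbers X k + ε * (‖A‖ / (‖A‖ + 1)) := by ring
    _ ≤ ‖A‖ * sNumbers X k + ε * 1 := by
      gcongr; exact (div_le_one (by positivity)).2 (by linarith)
    _ = _ := by ring

theorem sNumbers_mul_right_le (X B : H →L[ℂ] H) (k : ℕ) :
    sNumbers (X * B) k ≤ ‖B‖ * sNumbers X k := by
  refine le_of_forall_pos_le_add fun ε hε => ?_
  obtain ⟨F, hF, hF'⟩ := exists_norm_sub_lt X k (ε := ε / (‖B‖ + 1)) (by positivity)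
  have h1 : LinearMap.rank ((F * B : H →L[ℂ] H) : H →ₗ[ℂ] H) ≤ (k : Cardinal) :=
    (LinearMap.rank_comp_le_left (B : H →ₗ[ℂ] H) (F : H →ₗ[ℂ] H)).trans hF
  calc sNumbers (X * B) k ≤ ‖X * B - F * B‖ := sNumbers_le h1
    _ ≤ ‖X - F‖ * ‖B‖ := by rw [← sub_mul]; exact norm_mul_le _ _
    _ ≤ (sNumbers X k + ε / (‖B‖ + 1)) * ‖B‖ := by gcongr
    _ = ‖B‖ * sNumbers X k + ε * (‖B‖ / (‖B‖ + 1)) := by ring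
    _ ≤ ‖B‖ * sNumbers X k + ε * 1 := by
      gcongr; exact (div_le_one (by positivity)).2 (by linarith)
    _ = _ := by ring

theorem sNumbers_zero : sNumbers (0 : H →L[ℂ] H) = 0 := by
  ext k
  refine le_antisymm ?_ (sNumbers_nonneg _ _)
  simpa using sNumbers_le (X := 0) (F := (0 : H →L[ℂ] H)) (k := k) (by simp [LinearMap.rank_zero])

end sNumbers

/-- The singular numbers of an operator which is diagonalized by orthonormal systems. -/
theorem sNumbers_eq_norm_apply {X : H →L[ℂ] H} {e : ℕ → H} (he : Orthonormal ℂ e)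
    (horth : ∀ i j, i ≠ j → ⟪X (e i), X (e j)⟫_ℂ = 0) (hanti : Antitone fun n => ‖X (e n)‖)
    {n : ℕ} (hmax : ∀ v, (∀ i < n, ⟪e i, v⟫_ℂ = 0) → ‖X v‖ ≤ ‖X (e n)‖ * ‖v‖) :
    sNumbers X n = ‖X (e n)‖ := by
  classical
  apply le_antisymm
  -- Upper bound: `P` projects onto the span of the first `n` vectors, so `X * P` is a competitor of
  -- rank at most `n`.
  · let P : H →L[ℂ] H := ∑ i ∈ Finset.range n, (innerSL ℂ (e i)).smulRight (e i)
    have hP : ∀ v, P v = ∑ i ∈ Finset.range n, ⟪e i, v⟫_ℂ • e i := fun v => by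
      simp [P]
    clear_value P
    have hPe : ∀ v, ∀ i < n, ⟪e i, P v⟫_ℂ = ⟪e i, v⟫_ℂ := fun v i hi => by
      rw [hP, he.inner_right_sum _ (Finset.mem_range.2 hi)]
    have hrank : LinearMap.rank ((X * P : H →L[ℂ] H) : H →ₗ[ℂ] H) ≤ (n : Cardinal) := by
      refine (LinearMap.rank_comp_le_right (P : H →ₗ[ℂ] H) (X : H →ₗ[ℂ] H)).trans ?_
      have h1 : LinearMap.range (P : H →ₗ[ℂ] H) ≤
          Submodule.span ℂ ((Finset.range n).image e : Set H) := by
        rintro _ ⟨v, rfl⟩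
        change P v ∈ _
        rw [hP]
        refine Submodule.sum_mem _ fun i hi => Submodule.smul_mem _ _ (Submodule.subset_span ?_)
        exact Finset.mem_coe.2 (Finset.mem_image_of_mem e hi)
      refine (Submodule.rank_mono h1).trans ((rank_span_finset_le _).trans ?_)
      exact Nat.cast_le.2 (Finset.card_image_le.trans (Finset.card_range n).le)
    refine (sNumbers_le hrank).trans (ContinuousLinearMap.opNorm_le_bound _ (norm_nonneg _) ?_)
    intro v
    have h1 : (X - X * P) v = X (v - P v) := by simp
    rw [h1]
    refine (hmax _ fun i hi => ?_).trans ?_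
    · rw [inner_sub_right, hPe v i hi, sub_self]
    · gcongr
      have h2 : ⟪v - P v, P v⟫_ℂ = 0 := by
        rw [hP v, inner_sum]
        refine Finset.sum_eq_zero fun i hi => ?_
        have h3 : ⟪e i, v - P v⟫_ℂ = 0 := by
          rw [inner_sub_right, hPe v i (Finset.mem_range.1 hi), sub_self]
        rw [inner_smul_right, ← hP v, inner_eq_zero_symm.1 h3, mul_zero]
      have h3 := norm_add_sq_eq_norm_sq_add_norm_sq_of_inner_eq_zero _ _ h2
      rw [sub_add_cancel] at h3
      exact abs_le_of_sq_le_sq' (by nlinarith [norm_nonneg (P v)]) (norm_nonneg v) |>.2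
  -- Lower bound: the span of `e 0, …, e n` has dimension `n + 1`, so `F` kills a nonzero vector of
  -- it, and there `X` expands by at least `‖X (e n)‖`.
  · refine le_sNumbers fun F hF => ?_
    let L : (Fin (n + 1) → ℂ) →ₗ[ℂ] H := Fintype.linearCombination ℂ fun i : Fin (n + 1) => e i
    have hL : ∀ c, L c = ∑ i, c i • e i := fun c => Fintype.linearCombination_apply ..
    have hker : LinearMap.ker ((F : H →ₗ[ℂ] H) ∘ₗ L) ≠ ⊥ := by
      intro hbot
      have h1 := LinearMap.finrank_range_add_finrank_ker ((F : H →ₗ[ℂ] H) ∘ₗ L)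
      have h2 : Module.finrank ℂ (LinearMap.range ((F : H →ₗ[ℂ] H) ∘ₗ L)) ≤ n :=
        Module.finrank_le_of_rank_le ((LinearMap.rank_comp_le_left L (F : H →ₗ[ℂ] H)).trans hF)
      rw [hbot, finrank_bot] at h1
      simp at h1
      omega
    obtain ⟨c, hc, hc0⟩ := Submodule.exists_mem_ne_zero_of_ne_bot hker
    have hFv : F (L c) = 0 := hc
    have hoe : Orthonormal ℂ fun i : Fin (n + 1) => e i := he.comp _ Fin.val_injective
    have hv : ‖L c‖ ^ 2 = ∑ i, ‖c i‖ ^ 2 := by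
      rw [hL]
      have := hoe.inner_sum c c Finset.univ
      rw [inner_self_eq_norm_sq_to_K] at this
      have h4 : ∀ i, (starRingEnd ℂ) (c i) * c i = ((‖c i‖ ^ 2 : ℝ) : ℂ) := fun i => by
        rw [mul_comm, Complex.mul_conj, Complex.normSq_eq_norm_sq]
      simp only [h4] at this
      norm_cast at this
      exact Complex.ofReal_injective this
    have hXv : ‖X (L c)‖ ^ 2 = ∑ i, ‖c i‖ ^ 2 * ‖X (e i)‖ ^ 2 := by
      have h5 : ⟪X (L c), X (L c)⟫_ℂ = ((∑ i, ‖c i‖ ^ 2 * ‖X (e i)‖ ^ 2 : ℝ) : ℂ) := by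
        rw [hL, map_sum, sum_inner]
        push_cast
        refine Finset.sum_congr rfl fun i _ => ?_
        rw [inner_sum, Finset.sum_eq_single i]
        · rw [map_smul, inner_smul_left, inner_smul_right, inner_self_eq_norm_sq_to_K, ← mul_assoc,
            mul_comm _ (c i), Complex.mul_conj, Complex.normSq_eq_norm_sq]
          push_cast; rfl
        · intro j _ hj
          rw [map_smul, map_smul, inner_smul_left, inner_smul_right,
            horth _ _ (fun h => hj (Fin.ext h).symm), mul_zero, mul_zero]
        · simp
      rw [inner_self_eq_norm_sq_to_K] at h5
      norm_cast at h5
      exact Complex.ofReal_injective h5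
    have hpos : 0 < ‖L c‖ := by
      have : 0 < ‖L c‖ ^ 2 := by
        rw [hv]
        obtain ⟨i, hi⟩ := Function.ne_iff.1 hc0
        exact Finset.sum_pos' (fun _ _ => by positivity)
          ⟨i, Finset.mem_univ i, by have : 0 < ‖c i‖ := norm_pos_iff.2 hi; positivity⟩
      exact lt_of_le_of_ne (norm_nonneg _) fun h => by simp [← h] at this
    have h6 : ‖X (e n)‖ * ‖L c‖ ≤ ‖X (L c)‖ := by
      refine abs_le_of_sq_le_sq' ?_ (norm_nonneg _) |>.2
      rw [mul_pow, hv, hXv, Finset.mul_sum]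
      refine Finset.sum_le_sum fun i _ => ?_
      rw [mul_comm]
      gcongr
      exact hanti (Nat.lt_succ_iff.1 i.2)
    have h7 : ‖X (L c)‖ ≤ ‖X - F‖ * ‖L c‖ := by
      simpa [hFv] using (X - F).le_opNorm (L c)
    exact le_of_mul_le_mul_right (h6.trans h7) hpos

section Schmidt

variable [CompleteSpace H]

/-- Compress `X` to the orthogonal complement of `S`, giving `Y`. The norm of the compact
self-adjoint operator `Y* Y` is attained at an eigenvalue, and a unit eigenvector `u` maximizes `‖Y
u‖`. The eigenvalue equation also gives the last clause: `⟪Y u, Y v⟫` is a multiple of `⟪u, v⟫`. -/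
theorem exists_isMax_norm_apply (hH : ¬ FiniteDimensional ℂ H) {X : H →L[ℂ] H}
    (hX : IsCompactOperator X) (S : Finset H) :
    ∃ u : H, ‖u‖ = 1 ∧ (∀ e ∈ S, ⟪e, u⟫_ℂ = 0) ∧
      (∀ v, (∀ e ∈ S, ⟪e, v⟫_ℂ = 0) → ‖X v‖ ≤ ‖X u‖ * ‖v‖) ∧
      ∀ v, (∀ e ∈ S, ⟪e, v⟫_ℂ = 0) → ⟪u, v⟫_ℂ = 0 → ⟪X u, X v⟫_ℂ = 0 := by
  let K : Submodule ℂ H := Submodule.span ℂ (S : Set H)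
  have : FiniteDimensional ℂ K := FiniteDimensional.span_finset ℂ S
  have hmem : ∀ v, v ∈ Kᗮ ↔ ∀ e ∈ S, ⟪e, v⟫_ℂ = 0 := by
    intro v
    refine ⟨fun h e he => h e (Submodule.subset_span he), fun h x hx => ?_⟩
    induction hx using Submodule.span_induction with
    | mem x hx => exact h x hx
    | zero => simp
    | add x y _ _ hx hy => rw [inner_add_left, hx, hy, add_zero]
    | smul c x _ hx => rw [inner_smul_left, hx, mul_zero]
  simp only [← hmem]
  let Y : H →L[ℂ] H := X * Kᗮ.starProjection
  have hY : ∀ v ∈ Kᗮ, Y v = X v := fun v hv => by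
    simp [Y, Submodule.starProjection_eq_self_iff.2 hv]
  rcases eq_or_ne Y 0 with h0 | h0
  -- If `Y = 0`, any unit vector orthogonal to `S` works; one exists because `H` is
  -- infinite-dimensional.
  · have hne : Kᗮ ≠ ⊥ := by
      intro h
      rw [Submodule.orthogonal_eq_bot_iff] at h
      rw [h] at this
      exact hH (Submodule.topEquiv (R := ℂ) (M := H)).finiteDimensional
    obtain ⟨w, hw, hw0⟩ := Submodule.exists_mem_ne_zero_of_ne_bot hne
    have hX0 : ∀ v ∈ Kᗮ, X v = 0 := fun v hv => by rw [← hY v hv, h0]; rfl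
    refine ⟨((‖w‖⁻¹ : ℝ) : ℂ) • w, ?_, Submodule.smul_mem _ _ hw, fun v hv => ?_, fun v hv _ => ?_⟩
    · rw [norm_smul, Complex.norm_real, norm_inv, norm_norm, inv_mul_cancel₀ (norm_ne_zero_iff.2 hw0)]
    · rw [hX0 v hv, norm_zero]; positivity
    · rw [hX0 v hv, inner_zero_right]
  · have : Nontrivial H := by
      by_contra h
      rw [not_nontrivial_iff_subsingleton] at h
      exact h0 (Subsingleton.elim _ _)
    let T : H →L[ℂ] H := star Y * Y
    have hTsa : IsSelfAdjoint T := IsSelfAdjoint.star_mul_self Y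
    have hTc : IsCompactOperator T :=
      (hX.comp_clm (Kᗮ.starProjection)).clm_comp (star Y)
    have hTn : ‖T‖ = ‖Y‖ ^ 2 := by rw [CStarRing.norm_star_mul_self, sq]
    obtain ⟨μ, hμ, hμr⟩ := spectrum.exists_nnnorm_eq_spectralRadius T
    rw [T.spectralRadius_eq_nnnorm hTsa] at hμr
    have hμn : ‖μ‖ = ‖Y‖ ^ 2 := by
      rw [← hTn]
      exact congrArg NNReal.toReal (ENNReal.coe_injective hμr)
    have hμ0 : μ ≠ 0 := by
      rw [← norm_ne_zero_iff, hμn]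
      exact pow_ne_zero 2 (norm_ne_zero_iff.2 h0)
    obtain ⟨w, hw, hw0⟩ := ((hTc.hasEigenvalue_iff_mem_spectrum hμ0).2 hμ).exists_hasEigenvector
    have hTw : T w = μ • w := Module.End.mem_eigenspace_iff.1 hw
    let u : H := ((‖w‖⁻¹ : ℝ) : ℂ) • w
    have hu1 : ‖u‖ = 1 := by
      rw [norm_smul, Complex.norm_real, norm_inv, norm_norm, inv_mul_cancel₀ (norm_ne_zero_iff.2 hw0)]
    have hTu : T u = μ • u := by
      simp only [u, map_smul, hTw, smul_comm μ]
    have hinner : ∀ v, ⟪Y u, Y v⟫_ℂ = (starRingEnd ℂ) μ * ⟪u, v⟫_ℂ := by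
      intro v
      rw [← inner_smul_left, ← hTu]
      exact (ContinuousLinearMap.adjoint_inner_left Y v (Y u)).symm
    -- The range of `Y* Y` lies in `Kᗮ`, hence so does every eigenvector with nonzero eigenvalue.
    have hTu' : T u = Kᗮ.starProjection (star X (Y u)) := by
      refine ext_inner_right ℂ fun v => ?_
      rw [Submodule.inner_starProjection_left_eq_right]
      exact (ContinuousLinearMap.adjoint_inner_left Y v (Y u)).trans
        (ContinuousLinearMap.adjoint_inner_left X (Kᗮ.starProjection v) (Y u)).symm
    have huK : u ∈ Kᗮ := by
      have : u = μ⁻¹ • Kᗮ.starProjection (star X (Y u)) := by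
        rw [← hTu', hTu, inv_smul_smul₀ hμ0]
      rw [this]
      exact Submodule.smul_mem _ _ (Submodule.starProjection_apply_mem _ _)
    have hYu : ‖Y u‖ = ‖Y‖ := by
      have h1 := congrArg norm (hinner u)
      rw [inner_self_eq_norm_sq_to_K, inner_self_eq_norm_sq_to_K, hu1] at h1
      have h2 : ‖Y u‖ ^ 2 = ‖Y‖ ^ 2 := by simpa [hμn] using h1
      exact (pow_left_inj₀ (norm_nonneg _) (norm_nonneg _) two_ne_zero).1 h2
    refine ⟨u, hu1, huK, fun v hv => ?_, fun v hv huv => ?_⟩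
    · rw [← hY v hv, ← hY u huK, hYu]
      exact Y.le_opNorm v
    · rw [← hY v hv, ← hY u huK, hinner, huv, mul_zero]

/-- Schmidt decomposition of a compact operator, in terms of the right singular vectors. -/
theorem exists_orthonormal_sNumbers (hH : ¬ FiniteDimensional ℂ H) {X : H →L[ℂ] H}
    (hX : IsCompactOperator X) :
    ∃ e : ℕ → H, Orthonormal ℂ e ∧ (∀ n, ‖X (e n)‖ = sNumbers X n) ∧
      (∀ i j, i ≠ j → ⟪X (e i), X (e j)⟫_ℂ = 0) ∧
      ∀ n v, (∀ i < n, ⟪e i, v⟫_ℂ = 0) → ‖X v‖ ≤ sNumbers X n * ‖v‖ := by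
  classical
  choose g hg1 hg2 hg3 hg4 using exists_isMax_norm_apply hH hX
  -- Greedy choice: `S n` collects the first `n` vectors, and the next maximizes `‖X u‖` among unit
  -- vectors orthogonal to them.
  let S : ℕ → Finset H := fun n => Nat.rec ∅ (fun _ s => insert (g s) s) n
  have hS : ∀ n, S (n + 1) = insert (g (S n)) (S n) := fun n => rfl
  have hSmem : ∀ n x, x ∈ S n ↔ ∃ i < n, g (S i) = x := by
    intro n x
    induction n with
    | zero => simp [S]
    | succ n ih =>
      rw [hS, Finset.mem_insert, ih]
      constructor
      · rintro (h | ⟨i, hi, h⟩)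
        · exact ⟨n, n.lt_succ_self, h.symm⟩
        · exact ⟨i, hi.trans n.lt_succ_self, h⟩
      · rintro ⟨i, hi, h⟩
        rcases Nat.lt_succ_iff_lt_or_eq.1 hi with hi | rfl
        · exact Or.inr ⟨i, hi, h⟩
        · exact Or.inl h.symm
  let e : ℕ → H := fun n => g (S n)
  have hperp : ∀ n v, (∀ x ∈ S n, ⟪x, v⟫_ℂ = 0) ↔ ∀ i < n, ⟪e i, v⟫_ℂ = 0 := by
    intro n v
    constructor
    · exact fun h i hi => h _ ((hSmem n _).2 ⟨i, hi, rfl⟩)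
    · intro h x hx
      obtain ⟨i, hi, rfl⟩ := (hSmem n x).1 hx
      exact h i hi
  have hlt : ∀ i j, i < j → ⟪e i, e j⟫_ℂ = 0 := fun i j hij =>
    (hperp j (e j)).1 (hg2 (S j)) i hij
  have he : Orthonormal ℂ e := by
    refine ⟨fun n => hg1 _, fun i j hij => ?_⟩
    rcases lt_or_gt_of_ne hij with h | h
    · exact hlt i j h
    · exact inner_eq_zero_symm.1 (hlt j i h)
  have hmax : ∀ n v, (∀ i < n, ⟪e i, v⟫_ℂ = 0) → ‖X v‖ ≤ ‖X (e n)‖ * ‖v‖ := fun n v hv =>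
    hg3 (S n) v ((hperp n v).2 hv)
  have hXlt : ∀ i j, i < j → ⟪X (e i), X (e j)⟫_ℂ = 0 := fun i j hij =>
    hg4 (S i) (e j) ((hperp i (e j)).2 fun k hk => hlt k j (hk.trans hij)) (hlt i j hij)
  have horth : ∀ i j, i ≠ j → ⟪X (e i), X (e j)⟫_ℂ = 0 := by
    intro i j hij
    rcases lt_or_gt_of_ne hij with h | h
    · exact hXlt i j h
    · exact inner_eq_zero_symm.1 (hXlt j i h)
  have hanti : Antitone fun n => ‖X (e n)‖ := by
    intro m n hmn
    simpa [he.1 n] using hmax m (e n) fun i hi => hlt i n (hi.trans_le hmn)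
  have hs : ∀ n, sNumbers X n = ‖X (e n)‖ := fun n =>
    sNumbers_eq_norm_apply he horth hanti (hmax n)
  exact ⟨e, he, fun n => (hs n).symm, horth, fun n v hv => (hs n).symm ▸ hmax n v hv⟩

theorem exists_orthonormal_nat (hH : ¬ FiniteDimensional ℂ H) : ∃ e : ℕ → H, Orthonormal ℂ e :=
  let ⟨e, he, _⟩ := exists_orthonormal_sNumbers hH (X := (0 : H →L[ℂ] H)) isCompactOperator_zero
  ⟨e, he⟩

end Schmidt

end SingularNumbers

/-! ### Characteristic sets and the Calkin correspondence. -/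

section CharacteristicSet

theorem cZeroStar_nonneg {ξ : ℕ → ℝ} (hξ : ξ ∈ cZeroStar) (n : ℕ) : 0 ≤ ξ n :=
  hξ.1.le_of_tendsto hξ.2 n

theorem isBddSeq_of_mem_cZeroStar {ξ : ℕ → ℝ} (hξ : ξ ∈ cZeroStar) : IsBddSeq ξ :=
  ⟨ξ 0, fun n => by rw [abs_of_nonneg (cZeroStar_nonneg hξ n)]; exact hξ.1 (Nat.zero_le n)⟩

theorem cZeroStar_add {ξ η : ℕ → ℝ} (hξ : ξ ∈ cZeroStar) (hη : η ∈ cZeroStar) :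
    (fun n => ξ n + η n) ∈ cZeroStar :=
  ⟨fun _ _ h => add_le_add (hξ.1 h) (hη.1 h), by simpa using hξ.2.add hη.2⟩

theorem cZeroStar_half {ξ : ℕ → ℝ} (hξ : ξ ∈ cZeroStar) : (fun n => ξ (n / 2)) ∈ cZeroStar :=
  ⟨fun _ _ h => hξ.1 (Nat.div_le_div_right h),
    hξ.2.comp (Nat.tendsto_div_const_atTop two_ne_zero)⟩

theorem zero_mem_cZeroStar : (0 : ℕ → ℝ) ∈ cZeroStar :=
  ⟨fun _ _ _ => le_rfl, tendsto_const_nhds⟩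

theorem lOneStar_half {ξ : ℕ → ℝ} (hξ : ξ ∈ lOneStar) : (fun n => ξ (n / 2)) ∈ lOneStar := by
  refine ⟨cZeroStar_half hξ.1, ?_⟩
  refine (HasSum.even_add_odd (f := fun n => ξ (n / 2)) (m := ∑' n, ξ n) (m' := ∑' n, ξ n)
    ?_ ?_).summable
  · simpa using! hξ.2.hasSum
  · have h3 : ∀ k, (2 * k + 1) / 2 = k := fun k => by omega
    simpa [h3] using! hξ.2.hasSum

theorem lOneStar_add {ξ η : ℕ → ℝ} (hξ : ξ ∈ lOneStar) (hη : η ∈ lOneStar) :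
    (fun n => ξ n + η n) ∈ lOneStar :=
  ⟨cZeroStar_add hξ.1 hη.1, hξ.2.add hη.2⟩

variable {H : Type*} [NormedAddCommGroup H] [InnerProductSpace ℂ H] [CompleteSpace H]

omit [CompleteSpace H] in
theorem norm_sub_sq_of_inner_eq_zero {x y : H} (h : ⟪x, y⟫_ℂ = 0) :
    ‖x - y‖ ^ 2 = ‖x‖ ^ 2 + ‖y‖ ^ 2 := by
  rw [norm_sub_sq (𝕜 := ℂ), h]; simp

/-- If the singular numbers stayed above `L > 0`, the orthogonal vectors `X (e n)` would be at
mutual distance at least `√2 L`, and no subsequence could converge. -/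
theorem sNumbers_mem_cZeroStar (hH : ¬ FiniteDimensional ℂ H) {X : H →L[ℂ] H}
    (hX : IsCompactOperator X) : sNumbers X ∈ cZeroStar := by
  obtain ⟨e, he, hs, horth, -⟩ := exists_orthonormal_sNumbers hH hX
  refine ⟨sNumbers_antitone X, ?_⟩
  have hbdd : BddBelow (Set.range (sNumbers X)) :=
    ⟨0, by rintro _ ⟨k, rfl⟩; exact sNumbers_nonneg X k⟩
  have hlim := tendsto_atTop_ciInf (sNumbers_antitone X) hbdd
  set L := ⨅ n, sNumbers X n
  have hL : ∀ n, L ≤ sNumbers X n := fun n => ciInf_le hbdd n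
  have hL0 : 0 ≤ L := le_ciInf fun n => sNumbers_nonneg X n
  rcases hL0.eq_or_lt with h0 | hpos
  · rwa [← h0] at hlim
  exfalso
  obtain ⟨K, hK, hsub⟩ := IsCompactOperator.image_closedBall_subset_compact (f := (X : H →ₗ[ℂ] H))
    hX 1
  obtain ⟨y, -, φ, hφ, hy⟩ := hK.tendsto_subseq (x := fun n => X (e n)) fun n =>
    hsub ⟨e n, by simp [he.1 n], rfl⟩
  obtain ⟨N, hN⟩ := Metric.cauchySeq_iff.1 hy.cauchySeq L hpos
  have h1 := hN N le_rfl (N + 1) (Nat.le_succ N)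
  have h2 : φ N ≠ φ (N + 1) := (hφ N.lt_succ_self).ne
  have h3 := norm_sub_sq_of_inner_eq_zero (horth _ _ h2)
  simp only [Function.comp_apply, dist_eq_norm] at h1
  rw [hs, hs] at h3
  nlinarith [hL (φ N), hL (φ (N + 1)), norm_nonneg (X (e (φ N)) - X (e (φ (N + 1))))]

/-- A substitute for the polar decomposition: equality of norms is all that Douglas factorization
needs, so the left vectors `f` may be prescribed. -/
theorem exists_norm_apply_eq_diagOp (hH : ¬ FiniteDimensional ℂ H) {X : H →L[ℂ] H}
    (hX : IsCompactOperator X) (hb : IsBddSeq (sNumbers X)) {f : ℕ → H} (hf : Orthonormal ℂ f) :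
    ∃ (e : ℕ → H) (he : Orthonormal ℂ e), ∀ v, ‖X v‖ = ‖diagOp he hf hb v‖ := by
  obtain ⟨e, he, hs, horth, hmax⟩ := exists_orthonormal_sNumbers hH hX
  refine ⟨e, he, fun v => ?_⟩
  -- `w` is the projection of `v` onto the closed span of the `e n`. Since `v - w` is orthogonal to
  -- all of them, `‖X (v - w)‖ ≤ sNumbers X n * ‖v - w‖` for every `n`, which tends to `0`.
  let w := diagOp he he (isBddSeq_const 1) v
  have hw : ∀ n, ⟪e n, w⟫_ℂ = ⟪e n, v⟫_ℂ := fun n => by simp [w, inner_diagOp]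
  have hXw : X v = X w := by
    rw [← sub_eq_zero, ← map_sub, ← norm_le_zero_iff]
    have h1 : Filter.Tendsto (fun n => sNumbers X n * ‖v - w‖) Filter.atTop (nhds (0 * ‖v - w‖)) :=
      (sNumbers_mem_cZeroStar hH hX).2.mul_const _
    rw [zero_mul] at h1
    exact ge_of_tendsto' h1 fun n => hmax n _ fun i _ => by rw [inner_sub_right, hw, sub_self]
  have h2 : HasSum (fun n => ⟪e n, v⟫_ℂ • X (e n)) (X w) := by
    simpa using (hasSum_diagOp he he (isBddSeq_const 1) v).mapL X
  have h3 : ∀ m, ⟪X (e m), X w⟫_ℂ = ⟪e m, v⟫_ℂ * (sNumbers X m : ℂ) ^ 2 := by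
    intro m
    have h4 := h2.mapL (innerSL ℂ (X (e m)))
    simp only [innerSL_apply_apply, inner_smul_right] at h4
    rw [h4.unique (hasSum_single m fun n hn => by rw [horth m n hn.symm, mul_zero]),
      inner_self_eq_norm_sq_to_K, hs]
    rfl
  have h5 := h2.mapL (innerSL ℂ (X w))
  simp only [innerSL_apply_apply, inner_smul_right] at h5
  have h6 : ∀ n, ⟪e n, v⟫_ℂ * ⟪X w, X (e n)⟫_ℂ
      = ((sNumbers X n ^ 2 * ‖⟪e n, v⟫_ℂ‖ ^ 2 : ℝ) : ℂ) := by
    intro n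
    rw [← inner_conj_symm (X w), h3, map_mul, ← mul_assoc, Complex.mul_conj,
      Complex.normSq_eq_norm_sq, map_pow, Complex.conj_ofReal]
    push_cast; ring
  simp only [h6, inner_self_eq_norm_sq_to_K] at h5
  rw [show ((RCLike.ofReal ‖X w‖ : ℂ)) ^ 2 = ((‖X w‖ ^ 2 : ℝ) : ℂ) by push_cast; rfl] at h5
  have h7 := (Complex.hasSum_ofReal.1 h5).unique (hasSum_norm_sq_diagOp he hf hb v)
  rw [hXw]
  exact (pow_left_inj₀ (norm_nonneg _) (norm_nonneg _) two_ne_zero).1 h7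

theorem isCompactOperator_diagOp {e f : ℕ → H} (he : Orthonormal ℂ e) (hf : Orthonormal ℂ f)
    {ξ : ℕ → ℝ} (hb : IsBddSeq ξ) (hξ : ξ ∈ cZeroStar) : IsCompactOperator (diagOp he hf hb) := by
  let F : ℕ → (H →L[ℂ] H) := fun N =>
    ∑ n ∈ Finset.range N, (innerSL ℂ (e n)).smulRight ((ξ n : ℂ) • f n)
  have hF : ∀ N v, F N v = ∑ n ∈ Finset.range N, ((ξ n : ℂ) * ⟪e n, v⟫_ℂ) • f n := fun N v => by
    simp only [F, sum_apply, ContinuousLinearMap.smulRight_apply, innerSL_apply_apply, smul_smul,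
      mul_comm]
  have hFc : ∀ N, IsCompactOperator (F N) := by
    intro N
    change F N ∈ compactOperator (RingHom.id ℂ) H H
    refine Submodule.sum_mem _ fun n _ => ?_
    exact (isCompactOperator_of_locallyCompactSpace_rng
      (ContinuousLinearMap.toSpanSingleton ℂ ((ξ n : ℂ) • f n))).comp_clm (innerSL ℂ (e n))
  have hlim : Filter.Tendsto F Filter.atTop (nhds (diagOp he hf hb)) := by
    rw [tendsto_iff_norm_sub_tendsto_zero]
    refine squeeze_zero (fun _ => norm_nonneg _) (fun N => ?_) hξ.2
    have htail : IsBddSeq fun n => if n < N then 0 else ξ n := by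
      obtain ⟨C, hC⟩ := hb
      refine ⟨C, fun n => ?_⟩
      dsimp only
      split_ifs
      · simpa using (abs_nonneg _).trans (hC 0)
      · exact hC n
    have h1 : ∀ v, diagOp he hf hb v - F N v = diagOp he hf htail v := by
      intro v
      refine HasSum.unique ?_ (hasSum_diagOp he hf htail v)
      have h2 : HasSum (fun n => if n < N then ((ξ n : ℂ) * ⟪e n, v⟫_ℂ) • f n else 0) (F N v) := by
        rw [hF]
        convert hasSum_sum_of_ne_finset_zero (s := Finset.range N)
          (f := fun n => if n < N then ((ξ n : ℂ) * ⟪e n, v⟫_ℂ) • f n else 0) ?_ using 1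
        · exact Finset.sum_congr rfl fun n hn => (if_pos (Finset.mem_range.1 hn)).symm
        · exact fun n hn => if_neg fun h => hn (Finset.mem_range.2 h)
        · infer_instance
      convert (hasSum_diagOp he hf hb v).sub h2 using 2 with n
      split_ifs <;> simp
    rw [norm_sub_rev]
    refine ContinuousLinearMap.opNorm_le_bound _ (cZeroStar_nonneg hξ N) fun v => ?_
    rw [_root_.sub_apply, h1]
    refine norm_diagOp_apply_le he hf htail (fun n => ?_) v
    split_ifs with h
    · simpa using cZeroStar_nonneg hξ N
    · rw [abs_of_nonneg (cZeroStar_nonneg hξ n)]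
      exact hξ.1 (not_lt.1 h)
  exact isCompactOperator_of_tendsto hlim (Filter.Eventually.of_forall hFc)

theorem sNumbers_diagOp {e f : ℕ → H} (he : Orthonormal ℂ e) (hf : Orthonormal ℂ f)
    {ξ : ℕ → ℝ} (hb : IsBddSeq ξ) (hξ : ξ ∈ cZeroStar) : sNumbers (diagOp he hf hb) = ξ := by
  have hn : ∀ n, ‖diagOp he hf hb (e n)‖ = ξ n := fun n => by
    rw [diagOp_apply_self, norm_smul, hf.1, Complex.norm_real, mul_one, Real.norm_eq_abs,
      abs_of_nonneg (cZeroStar_nonneg hξ n)]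
  ext n
  rw [← hn n]
  apply sNumbers_eq_norm_apply he
  · intro i j hij
    rw [diagOp_apply_self, diagOp_apply_self, inner_smul_left, inner_smul_right, hf.2 hij,
      mul_zero, mul_zero]
  · simpa only [hn] using hξ.1
  · intro v hv
    rw [hn]
    refine abs_le_of_sq_le_sq' ?_ (mul_nonneg (cZeroStar_nonneg hξ n) (norm_nonneg _)) |>.2
    rw [mul_pow]
    refine (hasSum_le (fun k => ?_) (hasSum_norm_sq_diagOp he hf hb v)
      ((he.inner_products_summable (x := v)).hasSum.mul_left (ξ n ^ 2))).trans ?_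
    · rcases lt_or_ge k n with h | h
      · simp [hv k h]
      · gcongr
        · exact cZeroStar_nonneg hξ k
        · exact hξ.1 h
    · gcongr; exact he.tsum_inner_products_le v

/-- The two operators factor through each other, by Douglas factorization and a change of
orthonormal sequences. -/
theorem mem_iff_diagOp_mem (hH : ¬ FiniteDimensional ℂ H) {X : H →L[ℂ] H}
    (hX : IsCompactOperator X) (hb : IsBddSeq (sNumbers X)) {f : ℕ → H} (hf : Orthonormal ℂ f)
    {I : TwoSidedIdeal (H →L[ℂ] H)} : X ∈ I ↔ diagOp hf hf hb ∈ I := by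
  obtain ⟨e, he, h⟩ := exists_norm_apply_eq_diagOp hH hX hb hf
  constructor
  · exact fun hXI => diagOp_mem_of_mem he hf hb hf hf (mem_of_norm_apply_le (fun v => (h v).ge) hXI)
  · exact fun hD => mem_of_norm_apply_le (fun v => (h v).le) (diagOp_mem_of_mem hf hf hb he hf hD)

theorem cZeroStar_of_mem_charSet (hH : ¬ FiniteDimensional ℂ H) {I : TwoSidedIdeal (H →L[ℂ] H)}
    {ξ : ℕ → ℝ} (hξ : ξ ∈ charSet I) : ξ ∈ cZeroStar := by
  obtain ⟨X, -, hX, rfl⟩ := hξ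
  exact sNumbers_mem_cZeroStar hH hX

theorem mem_charSet_iff (hH : ¬ FiniteDimensional ℂ H) {I : TwoSidedIdeal (H →L[ℂ] H)}
    {f : ℕ → H} (hf : Orthonormal ℂ f) {ξ : ℕ → ℝ} (hξ : ξ ∈ cZeroStar) (hb : IsBddSeq ξ) :
    ξ ∈ charSet I ↔ diagOp hf hf hb ∈ I := by
  constructor
  · rintro ⟨X, hXI, hX, rfl⟩
    exact (mem_iff_diagOp_mem hH hX _ hf).1 hXI
  · exact fun h => ⟨_, h, isCompactOperator_diagOp hf hf hb hξ, sNumbers_diagOp hf hf hb hξ⟩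

theorem sNumbers_mem_charSet_iff (hH : ¬ FiniteDimensional ℂ H) {I : TwoSidedIdeal (H →L[ℂ] H)}
    {X : H →L[ℂ] H} (hX : IsCompactOperator X) : sNumbers X ∈ charSet I ↔ X ∈ I := by
  obtain ⟨f, hf⟩ := exists_orthonormal_nat hH
  have h := sNumbers_mem_cZeroStar hH hX
  rw [mem_charSet_iff hH hf h (isBddSeq_of_mem_cZeroStar h), ← mem_iff_diagOp_mem hH hX]

theorem charSet_of_le (hH : ¬ FiniteDimensional ℂ H) {I : TwoSidedIdeal (H →L[ℂ] H)}
    {ξ η : ℕ → ℝ} (hξ : ξ ∈ cZeroStar) (hη : η ∈ charSet I) {C : ℝ} (h : ∀ k, ξ k ≤ C * η k) :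
    ξ ∈ charSet I := by
  obtain ⟨f, hf⟩ := exists_orthonormal_nat hH
  have hη' := cZeroStar_of_mem_charSet hH hη
  rw [mem_charSet_iff hH hf hη' (isBddSeq_of_mem_cZeroStar hη')] at hη
  rw [mem_charSet_iff hH hf hξ (isBddSeq_of_mem_cZeroStar hξ)]
  refine diagOp_mem_of_abs_le hf hf _ _ (C := C) (fun n => ?_) hη
  rw [abs_of_nonneg (cZeroStar_nonneg hξ n), abs_of_nonneg (cZeroStar_nonneg hη' n)]
  exact h n

theorem charSet_add (hH : ¬ FiniteDimensional ℂ H) {I J : TwoSidedIdeal (H →L[ℂ] H)}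
    {ξ η : ℕ → ℝ} (hξ : ξ ∈ charSet I) (hη : η ∈ charSet J) :
    (fun k => ξ k + η k) ∈ charSet (I ⊔ J) := by
  obtain ⟨f, hf⟩ := exists_orthonormal_nat hH
  have hξ' := cZeroStar_of_mem_charSet hH hξ
  have hη' := cZeroStar_of_mem_charSet hH hη
  have hbξ := isBddSeq_of_mem_cZeroStar hξ'
  have hbη := isBddSeq_of_mem_cZeroStar hη'
  rw [mem_charSet_iff hH hf hξ' hbξ] at hξ
  rw [mem_charSet_iff hH hf hη' hbη] at hη
  rw [mem_charSet_iff hH hf (cZeroStar_add hξ' hη') (hbξ.add hbη), ← diagOp_add hf hf hbξ hbη]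
  exact TwoSidedIdeal.mem_sup.2 ⟨_, hξ, _, hη, rfl⟩

theorem charSet_half (hH : ¬ FiniteDimensional ℂ H) {I : TwoSidedIdeal (H →L[ℂ] H)}
    {ξ : ℕ → ℝ} (hξ : ξ ∈ charSet I) : (fun k => ξ (k / 2)) ∈ charSet I := by
  obtain ⟨f, hf⟩ := exists_orthonormal_nat hH
  have hξ' := cZeroStar_of_mem_charSet hH hξ
  have hb := isBddSeq_of_mem_cZeroStar hξ'
  rw [mem_charSet_iff hH hf hξ' hb] at hξ
  rw [mem_charSet_iff hH hf (cZeroStar_half hξ') (hb.comp _)]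
  exact diagOp_half_mem hf hf hb hξ

omit [CompleteSpace H] in
theorem charSet_mono {I J : TwoSidedIdeal (H →L[ℂ] H)} (h : I ≤ J) : charSet I ⊆ charSet J := by
  rintro _ ⟨X, hX, hc, rfl⟩
  exact ⟨X, h hX, hc, rfl⟩

omit [CompleteSpace H] in
theorem idealOf_mono {S T : Set (ℕ → ℝ)} (h : S ⊆ T) : idealOf H S ≤ idealOf H T :=
  TwoSidedIdeal.span_mono fun _ hX => ⟨hX.1, h hX.2⟩

omit [CompleteSpace H] in
theorem sNumbers_add_half_le (X Y : H →L[ℂ] H) (k : ℕ) :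
    sNumbers (X + Y) k ≤ sNumbers X (k / 2) + sNumbers Y (k / 2) :=
  (sNumbers_antitone _ (by omega)).trans (sNumbers_add_le X Y (k / 2) (k / 2))

/-- If `S` is hereditary and closed under addition up to ampliation, then all elements of the ideal
attached to `S` have their sequence of `s`-numbers in `S`. -/
theorem sNumbers_mem_of_mem_idealOf (hH : ¬ FiniteDimensional ℂ H) {S : Set (ℕ → ℝ)}
    (h0 : (0 : ℕ → ℝ) ∈ S)
    (hle : ∀ ξ ∈ cZeroStar, ∀ η ∈ S, ∀ C : ℝ, (∀ k, ξ k ≤ C * η k) → ξ ∈ S)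
    (hadd : ∀ ξ ∈ S, ∀ η ∈ S, ∃ ζ ∈ S, ∀ k, ξ (k / 2) + η (k / 2) ≤ ζ k)
    {X : H →L[ℂ] H} (hX : X ∈ idealOf H S) : IsCompactOperator X ∧ sNumbers X ∈ S := by
  induction hX using TwoSidedIdeal.span_induction with
  | mem X hX => exact hX
  | zero => exact ⟨isCompactOperator_zero, by rw [sNumbers_zero]; exact h0⟩
  | add X Y _ _ hX hY =>
    have hc : IsCompactOperator (X + Y : H →L[ℂ] H) := hX.1.add hY.1
    obtain ⟨ζ, hζ, h⟩ := hadd _ hX.2 _ hY.2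
    refine ⟨hc, hle _ (sNumbers_mem_cZeroStar hH hc) ζ hζ 1 fun k => ?_⟩
    rw [one_mul]
    exact (sNumbers_add_half_le X Y k).trans (h k)
  | neg X _ hX =>
    have hc : IsCompactOperator (-X : H →L[ℂ] H) := hX.1.neg
    refine ⟨hc, hle _ (sNumbers_mem_cZeroStar hH hc) _ hX.2 ‖(-1 : H →L[ℂ] H)‖ fun k => ?_⟩
    simpa using sNumbers_mul_left_le (-1) X k
  | left_absorb A X _ hX =>
    have hc : IsCompactOperator (A * X : H →L[ℂ] H) := hX.1.clm_comp A
    exact ⟨hc, hle _ (sNumbers_mem_cZeroStar hH hc) _ hX.2 ‖A‖ (sNumbers_mul_left_le A X)⟩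
  | right_absorb B X _ hX =>
    have hc : IsCompactOperator (X * B : H →L[ℂ] H) := hX.1.comp_clm B
    exact ⟨hc, hle _ (sNumbers_mem_cZeroStar hH hc) _ hX.2 ‖B‖ (sNumbers_mul_right_le X B)⟩

omit [CompleteSpace H] in
theorem mem_idealOf_of_sNumbers_mem {S : Set (ℕ → ℝ)} {X : H →L[ℂ] H} (hX : IsCompactOperator X)
    (h : sNumbers X ∈ S) : X ∈ idealOf H S :=
  TwoSidedIdeal.subset_span ⟨hX, h⟩

/-- No closure property of `S` is needed in this direction. It serves the pre-mean, whose defining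
set is therefore never shown to be characteristic. -/
theorem mem_charSet_idealOf (hH : ¬ FiniteDimensional ℂ H) {S : Set (ℕ → ℝ)} {ξ : ℕ → ℝ}
    (hξ : ξ ∈ cZeroStar) (h : ξ ∈ S) : ξ ∈ charSet (idealOf H S) := by
  obtain ⟨f, hf⟩ := exists_orthonormal_nat hH
  have hb := isBddSeq_of_mem_cZeroStar hξ
  have hc := isCompactOperator_diagOp hf hf hb hξ
  have hs := sNumbers_diagOp hf hf hb hξ
  exact ⟨_, mem_idealOf_of_sNumbers_mem hc (by rwa [hs]), hc, hs⟩

theorem mem_traceClass (hH : ¬ FiniteDimensional ℂ H) {X : H →L[ℂ] H} (hX : X ∈ traceClass H) :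
    IsCompactOperator X ∧ sNumbers X ∈ lOneStar := by
  refine sNumbers_mem_of_mem_idealOf (S := lOneStar) hH ⟨zero_mem_cZeroStar, summable_zero⟩
    ?_ ?_ hX
  · intro ξ hξ η hη C h
    exact ⟨hξ, Summable.of_nonneg_of_le (cZeroStar_nonneg hξ) h (hη.2.mul_left C)⟩
  · intro ξ hξ η hη
    exact ⟨_, lOneStar_half (lOneStar_add hξ hη), fun k => le_rfl⟩

theorem lOneStar_of_mem_charSet (hH : ¬ FiniteDimensional ℂ H) {I : TwoSidedIdeal (H →L[ℂ] H)}
    {ξ : ℕ → ℝ} (hξ : ξ ∈ charSet (I ⊓ traceClass H)) : ξ ∈ lOneStar := by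
  obtain ⟨X, hX, -, rfl⟩ := hξ
  exact (mem_traceClass hH ((TwoSidedIdeal.mem_inf _).1 hX).2).2

/-! ### Positive operators and distributivity of the lattice of ideals. -/

section positive

/-- `P ≤ Q` says `‖√P v‖ ≤ ‖√Q v‖`, so `√P = c √Q` by Douglas factorization. -/
theorem exists_eq_conj_of_le {P Q : H →L[ℂ] H} (hP : 0 ≤ P) (hPQ : P ≤ Q) :
    ∃ c : H →L[ℂ] H, P = c * Q * star c := by
  have hQ : 0 ≤ Q := hP.trans hPQ
  have hn : ∀ R : H →L[ℂ] H, 0 ≤ R → ∀ v, ‖CFC.sqrt R v‖ ^ 2 = (⟪R v, v⟫_ℂ).re := by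
    intro R hR v
    have hsa : star (CFC.sqrt R) = CFC.sqrt R := (CFC.sqrt_nonneg R).isSelfAdjoint
    have h1 : R v = star (CFC.sqrt R) (CFC.sqrt R v) := by
      conv_lhs => rw [← CFC.sqrt_mul_sqrt_self R]
      rw [hsa]; rfl
    have h2 : ⟪star (CFC.sqrt R) (CFC.sqrt R v), v⟫_ℂ = ⟪CFC.sqrt R v, CFC.sqrt R v⟫_ℂ :=
      ContinuousLinearMap.adjoint_inner_left _ _ _
    rw [h1, h2, inner_self_eq_norm_sq_to_K]
    norm_cast
  obtain ⟨c, hc⟩ := exists_eq_mul_of_norm_apply_le (X := CFC.sqrt P) (Y := CFC.sqrt Q) fun v => by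
    refine abs_le_of_sq_le_sq' ?_ (norm_nonneg _) |>.2
    rw [hn P hP, hn Q hQ]
    have h1 := ((ContinuousLinearMap.le_def P Q).1 hPQ).re_inner_nonneg_left v
    rw [_root_.sub_apply, inner_sub_left, map_sub] at h1
    exact sub_nonneg.1 h1
  refine ⟨c, ?_⟩
  have hsaP : star (CFC.sqrt P) = CFC.sqrt P := (CFC.sqrt_nonneg P).isSelfAdjoint
  have hsaQ : star (CFC.sqrt Q) = CFC.sqrt Q := (CFC.sqrt_nonneg Q).isSelfAdjoint
  calc P = CFC.sqrt P * star (CFC.sqrt P) := by rw [hsaP, CFC.sqrt_mul_sqrt_self P]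
    _ = c * (CFC.sqrt Q * CFC.sqrt Q) * star c := by
      rw [hc, star_mul, hsaQ]; simp only [mul_assoc]
    _ = _ := by rw [CFC.sqrt_mul_sqrt_self Q]

/-- `A⁺ v` and `A⁻ v` are orthogonal, whence `‖A⁺ v‖ ≤ ‖A v‖`. -/
theorem posPart_mem {I : TwoSidedIdeal (H →L[ℂ] H)} {A : H →L[ℂ] H} (hA : IsSelfAdjoint A)
    (h : A ∈ I) : A⁺ ∈ I := by
  refine mem_of_norm_apply_le (fun v => ?_) h
  refine abs_le_of_sq_le_sq' ?_ (norm_nonneg _) |>.2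
  have hsa : star A⁺ = A⁺ := (CFC.posPart_nonneg A).isSelfAdjoint
  have h1 : ⟪A⁺ v, A⁻ v⟫_ℂ = 0 := by
    have : ⟪star A⁺ v, A⁻ v⟫_ℂ = ⟪v, A⁺ (A⁻ v)⟫_ℂ := ContinuousLinearMap.adjoint_inner_left _ _ _
    rw [hsa] at this
    rw [this]
    have h2 : A⁺ (A⁻ v) = (A⁺ * A⁻) v := rfl
    rw [h2, CFC.posPart_mul_negPart]
    simp
  have h2 : A v = A⁺ v - A⁻ v := by
    conv_lhs => rw [← CFC.posPart_sub_negPart A hA]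
    rfl
  have h3 := norm_sub_sq_of_inner_eq_zero h1
  rw [h2]
  nlinarith [sq_nonneg ‖A⁻ v‖]

/-- With `S = |A|`, the equality `‖S v‖ = ‖A v‖` gives both `S ∈ I` and `A = C S`, and then `A* = S
C*`. -/
theorem star_mem {I : TwoSidedIdeal (H →L[ℂ] H)} {A : H →L[ℂ] H} (h : A ∈ I) : star A ∈ I := by
  set S := CFC.sqrt (star A * A)
  have hsa : star S = S := (CFC.sqrt_nonneg _).isSelfAdjoint
  have hSS : S * S = star A * A := CFC.sqrt_mul_sqrt_self _ (star_mul_self_nonneg A)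
  have hn : ∀ v, ‖S v‖ = ‖A v‖ := by
    intro v
    have h1 : ⟪S v, S v⟫_ℂ = ⟪A v, A v⟫_ℂ := by
      have h2 : ⟪star S (S v), v⟫_ℂ = ⟪S v, S v⟫_ℂ := ContinuousLinearMap.adjoint_inner_left _ _ _
      have h3 : ⟪star A (A v), v⟫_ℂ = ⟪A v, A v⟫_ℂ := ContinuousLinearMap.adjoint_inner_left _ _ _
      rw [← h2, ← h3, hsa]
      exact congrArg (fun T : H →L[ℂ] H => ⟪T v, v⟫_ℂ) hSS
    rw [inner_self_eq_norm_sq_to_K, inner_self_eq_norm_sq_to_K] at h1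
    norm_cast at h1
    exact (pow_left_inj₀ (norm_nonneg _) (norm_nonneg _) two_ne_zero).1 h1
  have hS : S ∈ I := mem_of_norm_apply_le (fun v => (hn v).le) h
  obtain ⟨C, hC⟩ := exists_eq_mul_of_norm_apply_le fun v => (hn v).ge
  rw [hC, star_mul, hsa]
  exact I.mul_mem_right _ _ hS

theorem exists_selfAdjoint_add_of_mem_sup {I J : TwoSidedIdeal (H →L[ℂ] H)} {Z : H →L[ℂ] H}
    (hZ : IsSelfAdjoint Z) (h : Z ∈ I ⊔ J) :
    ∃ A ∈ I, ∃ B ∈ J, IsSelfAdjoint A ∧ IsSelfAdjoint B ∧ A + B = Z := by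
  obtain ⟨A, hA, B, hB, hAB⟩ := TwoSidedIdeal.mem_sup.1 h
  have hsm : ∀ T : H →L[ℂ] H, IsSelfAdjoint ((2⁻¹ : ℂ) • (T + star T)) := fun T => by
    rw [isSelfAdjoint_iff, star_smul, star_add, star_star, add_comm]; simp
  refine ⟨_, smul_mem 2⁻¹ (I.add_mem hA (star_mem hA)), _,
    smul_mem 2⁻¹ (J.add_mem hB (star_mem hB)), hsm A, hsm B, ?_⟩
  have h1 : (A + star A) + (B + star B) = (2 : ℂ) • Z := by
    have : star A + star B = Z := by rw [← star_add, hAB, hZ]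
    calc (A + star A) + (B + star B) = (A + B) + (star A + star B) := by abel
      _ = (2 : ℂ) • Z := by rw [hAB, this, two_smul]
  rw [← smul_add, h1, smul_smul]
  norm_num

/-- Distributivity of the lattice of ideals, for positive operators. -/
theorem exists_nonneg_add_of_mem_sup {I J K : TwoSidedIdeal (H →L[ℂ] H)} {Z : H →L[ℂ] H}
    (hZ : 0 ≤ Z) (h : Z ∈ (I ⊔ J) ⊓ K) : ∃ A ∈ I ⊓ K, ∃ B ∈ J ⊓ K, A + B = Z := by
  obtain ⟨hIJ, hK⟩ := (TwoSidedIdeal.mem_inf _).1 h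
  obtain ⟨A, hA, B, hB, hAs, hBs, hAB⟩ := exists_selfAdjoint_add_of_mem_sup hZ.isSelfAdjoint hIJ
  -- Writing `Z = c (A⁺ + B⁺) c*` splits `Z` into positive summands from `I` and `J`. Each lies
  -- below `Z`, so it is a conjugate of `Z` and belongs to `K`.
  have hle : Z ≤ A⁺ + B⁺ := hAB ▸ add_le_add (CFC.le_posPart hAs) (CFC.le_posPart hBs)
  obtain ⟨c, hc⟩ := exists_eq_conj_of_le hZ hle
  have hpos : ∀ T : H →L[ℂ] H, 0 ≤ c * T⁺ * star c := fun T =>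
    star_right_conjugate_nonneg (CFC.posPart_nonneg T) c
  have hsum : c * A⁺ * star c + c * B⁺ * star c = Z := by
    rw [hc]; simp only [mul_add, add_mul]
  have hKmem : ∀ P, 0 ≤ P → P ≤ Z → P ∈ K := by
    intro P hP hPZ
    obtain ⟨d, hd⟩ := exists_eq_conj_of_le hP hPZ
    rw [hd]
    exact K.mul_mem_right _ _ (K.mul_mem_left _ _ hK)
  refine ⟨_, (TwoSidedIdeal.mem_inf _).2 ⟨I.mul_mem_right _ _ (I.mul_mem_left _ _
      (posPart_mem hAs hA)), hKmem _ (hpos A) ?_⟩, _, (TwoSidedIdeal.mem_inf _).2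
      ⟨J.mul_mem_right _ _ (J.mul_mem_left _ _ (posPart_mem hBs hB)), hKmem _ (hpos B) ?_⟩, hsum⟩
  · rw [← hsum]; exact le_add_of_nonneg_right (hpos B)
  · rw [← hsum]; exact le_add_of_nonneg_left (hpos A)

theorem diagOp_nonneg {f : ℕ → H} (hf : Orthonormal ℂ f) {ξ : ℕ → ℝ} (hb : IsBddSeq ξ)
    (h0 : ∀ n, 0 ≤ ξ n) : 0 ≤ diagOp hf hf hb := by
  rw [ContinuousLinearMap.nonneg_iff_isPositive, ContinuousLinearMap.isPositive_iff_complex]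
  intro v
  have h1 : HasSum (fun n => ((ξ n * ‖⟪f n, v⟫_ℂ‖ ^ 2 : ℝ) : ℂ)) ⟪v, diagOp hf hf hb v⟫_ℂ := by
    have h2 := (hasSum_diagOp hf hf hb v).mapL (innerSL ℂ v)
    simp only [innerSL_apply_apply, inner_smul_right] at h2
    have h3 : ∀ n, (ξ n : ℂ) * ⟪f n, v⟫_ℂ * ⟪v, f n⟫_ℂ
        = ((ξ n * ‖⟪f n, v⟫_ℂ‖ ^ 2 : ℝ) : ℂ) := fun n => by
      rw [← inner_conj_symm v (f n), mul_assoc, Complex.mul_conj, Complex.normSq_eq_norm_sq]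
      push_cast; rfl
    simpa only [h3] using h2
  obtain ⟨r, hr⟩ : Summable fun n => ξ n * ‖⟪f n, v⟫_ℂ‖ ^ 2 := Complex.summable_ofReal.1 h1.summable
  have h3 : ⟪v, diagOp hf hf hb v⟫_ℂ = (r : ℂ) := h1.unique (Complex.hasSum_ofReal.2 hr)
  have h4 : ⟪diagOp hf hf hb v, v⟫_ℂ = (r : ℂ) := by
    rw [← inner_conj_symm, h3, Complex.conj_ofReal]
  rw [h4]
  exact ⟨by simp, by simpa using hr.nonneg fun n => mul_nonneg (h0 n) (sq_nonneg _)⟩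

/-- Split the positive diagonal operator of `η`. Singular numbers of a sum at `k` are controlled at
`k / 2`, so `α` and `β` are ampliations. -/
theorem exists_charSet_inf_of_mem_sup_inf (hH : ¬ FiniteDimensional ℂ H)
    {I J K : TwoSidedIdeal (H →L[ℂ] H)} (hK : ∀ X ∈ K, IsCompactOperator X) {η : ℕ → ℝ}
    (hη : η ∈ charSet ((I ⊔ J) ⊓ K)) :
    ∃ α ∈ charSet (I ⊓ K), ∃ β ∈ charSet (J ⊓ K), ∀ k, η k ≤ α k + β k := by
  obtain ⟨f, hf⟩ := exists_orthonormal_nat hH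
  have hc := cZeroStar_of_mem_charSet hH hη
  have hb := isBddSeq_of_mem_cZeroStar hc
  rw [mem_charSet_iff hH hf hc hb] at hη
  obtain ⟨A, hA, B, hB, hAB⟩ :=
    exists_nonneg_add_of_mem_sup (diagOp_nonneg hf hb (cZeroStar_nonneg hc)) hη
  refine ⟨_, charSet_half hH ⟨A, hA, hK A ((TwoSidedIdeal.mem_inf _).1 hA).2, rfl⟩, _,
    charSet_half hH ⟨B, hB, hK B ((TwoSidedIdeal.mem_inf _).1 hB).2, rfl⟩, fun k => ?_⟩
  have h := sNumbers_add_half_le A B k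
  rwa [hAB, sNumbers_diagOp hf hf hb hc] at h

end positive

end CharacteristicSet

section AmInfClosure

/-! ### Tail sums, envelopes and the Riesz decomposition of sequences. -/

section sequences

/-- The tail sum `∑_{j ≥ m} ξ j`. -/
def tail (ξ : ℕ → ℝ) (m : ℕ) : ℝ := ∑' j, ξ (m + j)

theorem amInfSeq_eq (ξ : ℕ → ℝ) (k : ℕ) : amInfSeq ξ k = 1 / ((k : ℝ) + 1) * tail ξ (k + 1) := rfl

theorem summable_shift {ξ : ℕ → ℝ} (hξ : ξ ∈ lOneStar) (m : ℕ) : Summable fun j => ξ (m + j) := by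
  simpa only [add_comm m] using (summable_nat_add_iff m).2 hξ.2

theorem tail_nonneg {ξ : ℕ → ℝ} (hξ : ξ ∈ lOneStar) (m : ℕ) : 0 ≤ tail ξ m :=
  tsum_nonneg fun _ => cZeroStar_nonneg hξ.1 _

theorem sum_add_tail {ξ : ℕ → ℝ} (hξ : ξ ∈ lOneStar) (m n : ℕ) :
    ∑ i ∈ Finset.range n, ξ (m + i) + tail ξ (m + n) = tail ξ m := by
  rw [tail, tail, ← (summable_shift hξ m).sum_add_tsum_nat_add n]
  simp only [add_comm, add_left_comm]

theorem tail_antitone {ξ : ℕ → ℝ} (hξ : ξ ∈ lOneStar) : Antitone (tail ξ) := by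
  intro m n h
  obtain ⟨d, rfl⟩ := Nat.exists_eq_add_of_le h
  rw [← sum_add_tail hξ m d]
  exact le_add_of_nonneg_left (Finset.sum_nonneg fun _ _ => cZeroStar_nonneg hξ.1 _)

theorem tail_mono {ξ η : ℕ → ℝ} (hξ : ξ ∈ lOneStar) (hη : η ∈ lOneStar) (h : ∀ n, ξ n ≤ η n)
    (m : ℕ) : tail ξ m ≤ tail η m :=
  (summable_shift hξ m).tsum_le_tsum (fun _ => h _) (summable_shift hη m)

theorem tail_add {ξ η : ℕ → ℝ} (hξ : ξ ∈ lOneStar) (hη : η ∈ lOneStar) (m : ℕ) :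
    tail (fun n => ξ n + η n) m = tail ξ m + tail η m :=
  (summable_shift hξ m).tsum_add (summable_shift hη m)

theorem tail_half {ξ : ℕ → ℝ} (hξ : ξ ∈ lOneStar) (m : ℕ) :
    tail (fun n => ξ (n / 2)) (2 * m) = 2 * tail ξ m := by
  have h := (summable_shift hξ m).hasSum
  refine (HasSum.even_add_odd (f := fun j => ξ ((2 * m + j) / 2)) (m := tail ξ m)
    (m' := tail ξ m) ?_ ?_).tsum_eq.trans (two_mul _).symm
  · have h3 : ∀ k, (2 * m + 2 * k) / 2 = m + k := fun k => by omega
    simpa only [h3, tail] using h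
  · have h3 : ∀ k, (2 * m + (2 * k + 1)) / 2 = m + k := fun k => by omega
    simpa only [h3, tail] using h

theorem two_mul_tail_le_tail_half {ξ : ℕ → ℝ} (hξ : ξ ∈ lOneStar) (k : ℕ) :
    2 * tail ξ (k / 2 + 1) ≤ tail (fun n => ξ (n / 2)) (k + 1) := by
  rw [← tail_half hξ]
  exact tail_antitone (lOneStar_half hξ) (by omega)

theorem amInfSeq_nonneg {ξ : ℕ → ℝ} (hξ : ξ ∈ lOneStar) (k : ℕ) : 0 ≤ amInfSeq ξ k :=
  mul_nonneg (by positivity) (tail_nonneg hξ _)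

theorem amInfSeq_mem_cZeroStar {ξ : ℕ → ℝ} (hξ : ξ ∈ lOneStar) : amInfSeq ξ ∈ cZeroStar := by
  constructor
  · intro m n h
    rw [amInfSeq_eq, amInfSeq_eq]
    refine mul_le_mul ?_ (tail_antitone hξ (by omega)) (tail_nonneg hξ _) (by positivity)
    gcongr
  · have h1 : Filter.Tendsto (fun k : ℕ => 1 / ((k : ℝ) + 1) * tail ξ 0) Filter.atTop (nhds 0) := by
      simpa using (tendsto_one_div_add_atTop_nhds_zero_nat (𝕜 := ℝ)).mul_const (tail ξ 0)
    refine squeeze_zero (amInfSeq_nonneg hξ) (fun k => ?_) h1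
    rw [amInfSeq_eq]
    gcongr
    exact tail_antitone hξ (Nat.zero_le _)

theorem amInfSeq_mono {ξ η : ℕ → ℝ} (hξ : ξ ∈ lOneStar) (hη : η ∈ lOneStar) (h : ∀ n, ξ n ≤ η n)
    (k : ℕ) : amInfSeq ξ k ≤ amInfSeq η k :=
  mul_le_mul_of_nonneg_left (tail_mono hξ hη h _) (by positivity)

theorem amInfSeq_add {ξ η : ℕ → ℝ} (hξ : ξ ∈ lOneStar) (hη : η ∈ lOneStar) (k : ℕ) :
    amInfSeq (fun n => ξ n + η n) k = amInfSeq ξ k + amInfSeq η k := by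
  rw [amInfSeq_eq, tail_add hξ hη, mul_add]; rfl

/-- Ampliation doubles tails, which offsets the smaller prefactor, as `k + 1 ≤ 2 (k / 2 + 1)`. -/
theorem amInfSeq_le_amInfSeq_half {ξ : ℕ → ℝ} (hξ : ξ ∈ lOneStar) (k : ℕ) :
    amInfSeq ξ (k / 2) ≤ amInfSeq (fun n => ξ (n / 2)) k := by
  have h1 : (k : ℝ) + 1 ≤ 2 * (((k / 2 : ℕ) : ℝ) + 1) := by
    have : k + 1 ≤ 2 * (k / 2 + 1) := by omega
    exact_mod_cast this
  calc amInfSeq ξ (k / 2) = 1 / (2 * (((k / 2 : ℕ) : ℝ) + 1)) * (2 * tail ξ (k / 2 + 1)) := by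
        rw [amInfSeq_eq]; field_simp
    _ ≤ 1 / ((k : ℝ) + 1) * tail (fun n => ξ (n / 2)) (k + 1) := by
        refine mul_le_mul ?_ (two_mul_tail_le_tail_half hξ k)
          (mul_nonneg zero_le_two (tail_nonneg hξ _)) (by positivity)
        exact one_div_le_one_div_of_le (by positivity) h1

open Classical in
/-- The least nonincreasing nonnegative sequence which dominates `ξ` on `A`, for nonincreasing
nonnegative `ξ`. -/
def envelope (ξ : ℕ → ℝ) (A : Set ℕ) (n : ℕ) : ℝ :=
  if h : ∃ k, n ≤ k ∧ k ∈ A then ξ (Nat.find h) else 0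

theorem envelope_eq_zero {ξ : ℕ → ℝ} {A : Set ℕ} {n : ℕ} (h : ¬ ∃ k, n ≤ k ∧ k ∈ A) :
    envelope ξ A n = 0 := dif_neg h

/-- `y` is the first element of `A` from `n` on; the envelope has a plateau up to it. -/
theorem exists_envelope_eq {ξ : ℕ → ℝ} {A : Set ℕ} {n : ℕ} (h : ∃ k, n ≤ k ∧ k ∈ A) :
    ∃ y ∈ A, n ≤ y ∧ ∀ m, n ≤ m → m ≤ y → envelope ξ A m = ξ y := by
  classical
  refine ⟨Nat.find h, (Nat.find_spec h).2, (Nat.find_spec h).1, fun m hnm hmy => ?_⟩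
  have hm : ∃ k, m ≤ k ∧ k ∈ A := ⟨_, hmy, (Nat.find_spec h).2⟩
  have heq : Nat.find hm = Nat.find h :=
    le_antisymm (Nat.find_min' hm ⟨hmy, (Nat.find_spec h).2⟩)
      (Nat.find_min' h ⟨hnm.trans (Nat.find_spec hm).1, (Nat.find_spec hm).2⟩)
  rw [envelope, dif_pos hm]
  convert congrArg ξ heq

theorem envelope_of_mem {ξ : ℕ → ℝ} (hξ : ξ ∈ cZeroStar) {A : Set ℕ} {n : ℕ} (hn : n ∈ A) :
    ξ n ≤ envelope ξ A n := by
  classical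
  have h : ∃ k, n ≤ k ∧ k ∈ A := ⟨n, le_rfl, hn⟩
  rw [envelope, dif_pos h]
  exact hξ.1 (Nat.find_min' h ⟨le_rfl, hn⟩)

theorem envelope_nonneg {ξ : ℕ → ℝ} (hξ : ξ ∈ cZeroStar) (A : Set ℕ) (n : ℕ) :
    0 ≤ envelope ξ A n := by
  rw [envelope]
  split_ifs
  · exact cZeroStar_nonneg hξ _
  · exact le_rfl

theorem envelope_le {ξ : ℕ → ℝ} (hξ : ξ ∈ cZeroStar) (A : Set ℕ) (n : ℕ) :
    envelope ξ A n ≤ ξ n := by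
  by_cases h : ∃ k, n ≤ k ∧ k ∈ A
  · obtain ⟨y, -, hny, hy⟩ := exists_envelope_eq (ξ := ξ) h
    rw [hy n le_rfl hny]
    exact hξ.1 hny
  · rw [envelope_eq_zero h]
    exact cZeroStar_nonneg hξ n

theorem envelope_mem_lOneStar {ξ : ℕ → ℝ} (hξ : ξ ∈ lOneStar) (A : Set ℕ) :
    envelope ξ A ∈ lOneStar := by
  refine ⟨⟨fun m n hmn => ?_, squeeze_zero (envelope_nonneg hξ.1 A) (envelope_le hξ.1 A) hξ.1.2⟩,
    Summable.of_nonneg_of_le (envelope_nonneg hξ.1 A) (envelope_le hξ.1 A) hξ.2⟩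
  by_cases h : ∃ k, m ≤ k ∧ k ∈ A
  · obtain ⟨y, -, hmy, hy⟩ := exists_envelope_eq (ξ := ξ) h
    rcases le_total n y with hny | hny
    · rw [hy n hmn hny, hy m le_rfl hmy]
    · rw [hy m le_rfl hmy]
      exact (envelope_le hξ.1 A n).trans (hξ.1.1 hny)
  · rw [envelope_eq_zero fun ⟨k, hk, hkA⟩ => h ⟨k, hmn.trans hk, hkA⟩]
    exact envelope_nonneg hξ.1 A m

/-- The `y - y / 2` entries with indices from `y / 2 + 1` to `y` are each at least `ξ y`, and they
number at least half of `y`. -/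
theorem mul_add_tail_le {ξ : ℕ → ℝ} (hξ : ξ ∈ lOneStar) (y : ℕ) :
    y * ξ y + tail ξ (y + 1) ≤ 2 * tail ξ (y / 2 + 1) := by
  have h1 := sum_add_tail hξ (y / 2 + 1) (y - y / 2)
  rw [show y / 2 + 1 + (y - y / 2) = y + 1 by omega] at h1
  have h2 : ((y - y / 2 : ℕ) : ℝ) * ξ y
      ≤ ∑ i ∈ Finset.range (y - y / 2), ξ (y / 2 + 1 + i) := by
    rw [← nsmul_eq_mul]
    conv_lhs => rw [← Finset.card_range (y - y / 2)]
    refine Finset.card_nsmul_le_sum _ _ _ fun i hi => ?_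
    have := Finset.mem_range.1 hi
    exact hξ.1.1 (by omega)
  have h3 : (y : ℝ) ≤ 2 * ((y - y / 2 : ℕ) : ℝ) := by
    have : y ≤ 2 * (y - y / 2) := by omega
    exact_mod_cast this
  nlinarith [cZeroStar_nonneg hξ.1 y, tail_nonneg hξ (y + 1)]

/-- Past `k` the envelope is a plateau of height `ξ y` up to the next `y ∈ A`, followed by at most
the tail of `ξ`. The comparison of tails is thus needed only at points of `A`, and at the halved
index `y / 2 + 1`, where `mul_add_tail_le` bounds plateau and tail together. -/
theorem amInfSeq_envelope_le {ξ a : ℕ → ℝ} (hξ : ξ ∈ lOneStar) (ha : a ∈ lOneStar) {A : Set ℕ}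
    {C : ℝ} (hC : 0 ≤ C) (h : ∀ y ∈ A, tail ξ (y / 2 + 1) ≤ C * tail a (y / 2 + 1)) (k : ℕ) :
    amInfSeq (envelope ξ A) k ≤ C * amInfSeq (fun n => a (n / 2)) k := by
  have he := envelope_mem_lOneStar hξ A
  have key : tail (envelope ξ A) (k + 1) ≤ C * tail (fun n => a (n / 2)) (k + 1) := by
    by_cases hA : ∃ y, k + 1 ≤ y ∧ y ∈ A
    · obtain ⟨y, hyA, hky, hy⟩ := exists_envelope_eq (ξ := ξ) hA
      have h1 := sum_add_tail he (k + 1) (y - k)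
      rw [show k + 1 + (y - k) = y + 1 by omega] at h1
      have h2 : ∑ i ∈ Finset.range (y - k), envelope ξ A (k + 1 + i) = ((y - k : ℕ) : ℝ) * ξ y := by
        rw [← nsmul_eq_mul, Finset.sum_congr rfl fun i hi => hy (k + 1 + i) (by omega)
          (by have := Finset.mem_range.1 hi; omega), Finset.sum_const, Finset.card_range]
      have h3 : ((y - k : ℕ) : ℝ) ≤ y := by exact_mod_cast Nat.sub_le y k
      calc tail (envelope ξ A) (k + 1) ≤ y * ξ y + tail ξ (y + 1) := by
            rw [← h1, h2]
            exact add_le_add (mul_le_mul_of_nonneg_right h3 (cZeroStar_nonneg hξ.1 y))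
              (tail_mono he hξ (envelope_le hξ.1 A) _)
        _ ≤ 2 * tail ξ (y / 2 + 1) := mul_add_tail_le hξ y
        _ ≤ 2 * (C * tail a (y / 2 + 1)) := by gcongr; exact h y hyA
        _ ≤ 2 * (C * tail a (k / 2 + 1)) := by
            gcongr
            exact tail_antitone ha (by omega)
        _ = C * (2 * tail a (k / 2 + 1)) := by ring
        _ ≤ _ := by gcongr; exact two_mul_tail_le_tail_half ha k
    · have h1 : tail (envelope ξ A) (k + 1) = 0 := by
        rw [tail, ← tsum_zero (β := ℕ)]
        congr 1; ext j
        exact envelope_eq_zero fun ⟨y, hy, hyA⟩ => hA ⟨y, by omega, hyA⟩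
      rw [h1]
      exact mul_nonneg hC (tail_nonneg (lOneStar_half ha) _)
  rw [amInfSeq_eq, amInfSeq_eq, mul_left_comm]
  gcongr

/-- Riesz decomposition, up to constants and ampliation, for the tail majorization order. -/
theorem exists_le_add_of_amInfSeq_le {ξ a b : ℕ → ℝ} (hξ : ξ ∈ lOneStar) (ha : a ∈ lOneStar)
    (hb : b ∈ lOneStar) {M : ℝ} (hM : 0 ≤ M)
    (h : ∀ k, amInfSeq ξ k ≤ M * (amInfSeq a k + amInfSeq b k)) :
    ∃ ξ₁ ∈ lOneStar, ∃ ξ₂ ∈ lOneStar, (∀ k, ξ k ≤ ξ₁ k + ξ₂ k) ∧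
      (∀ k, amInfSeq ξ₁ k ≤ 2 * M * amInfSeq (fun n => a (n / 2)) k) ∧
      ∀ k, amInfSeq ξ₂ k ≤ 2 * M * amInfSeq (fun n => b (n / 2)) k := by
  have h' : ∀ k, tail ξ (k + 1) ≤ M * (tail a (k + 1) + tail b (k + 1)) := by
    intro k
    have h1 := h k
    rw [amInfSeq_eq, amInfSeq_eq, amInfSeq_eq, ← mul_add, mul_left_comm] at h1
    exact le_of_mul_le_mul_left h1 (by positivity)
  -- Tails are compared at `k / 2 + 1` because `amInfSeq_envelope_le` asks for its hypothesis there;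
  -- on each class the larger tail yields the constant `2 * M`.
  let A : Set ℕ := {k | tail b (k / 2 + 1) ≤ tail a (k / 2 + 1)}
  refine ⟨envelope ξ A, envelope_mem_lOneStar hξ A, envelope ξ Aᶜ, envelope_mem_lOneStar hξ Aᶜ,
    fun k => ?_, amInfSeq_envelope_le hξ ha (by positivity) fun y hy => ?_,
    amInfSeq_envelope_le hξ hb (by positivity) fun y hy => ?_⟩
  · by_cases hk : k ∈ A
    · exact (envelope_of_mem hξ.1 hk).trans (le_add_of_nonneg_right (envelope_nonneg hξ.1 _ k))
    · exact (envelope_of_mem (A := Aᶜ) hξ.1 hk).trans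
        (le_add_of_nonneg_left (envelope_nonneg hξ.1 _ k))
  · have hy' : tail b (y / 2 + 1) ≤ tail a (y / 2 + 1) := hy
    refine (h' _).trans ?_
    rw [mul_comm 2 M, mul_assoc]
    gcongr
    linarith
  · have hy' : tail a (y / 2 + 1) ≤ tail b (y / 2 + 1) := (lt_of_not_ge (show ¬ tail b (y / 2 + 1) ≤ tail a (y / 2 + 1) from hy)).le
    refine (h' _).trans ?_
    rw [mul_comm 2 M, mul_assoc]
    gcongr
    linarith

end sequences

/-! ### The am-`∞` closure of a sum of ideals. -/

variable {H : Type*} [NormedAddCommGroup H] [InnerProductSpace ℂ H]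

theorem amInf_mono {I J : TwoSidedIdeal (H →L[ℂ] H)} (h : I ≤ J) : amInf I ≤ amInf J :=
  idealOf_mono fun _ ⟨hξ, η, hη, hM⟩ => ⟨hξ, η, charSet_mono (inf_le_inf_right _ h) hη, hM⟩

theorem preAmInf_of_ne_bot {I : TwoSidedIdeal (H →L[ℂ] H)} (h : I ≠ ⊥) :
    preAmInf I = idealOf H {ξ | ξ ∈ lOneStar ∧ amInfSeq ξ ∈ charSet I} := if_neg h

theorem preAmInf_mono {I J : TwoSidedIdeal (H →L[ℂ] H)} (h : I ≤ J) : preAmInf I ≤ preAmInf J := by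
  by_cases hI : I = ⊥
  · rw [preAmInf, if_pos hI]; exact bot_le
  · rw [preAmInf_of_ne_bot hI, preAmInf_of_ne_bot fun hJ => hI (le_bot_iff.1 (hJ ▸ h))]
    exact idealOf_mono fun _ hξ => ⟨hξ.1, charSet_mono h hξ.2⟩

theorem amInfClosure_mono {I J : TwoSidedIdeal (H →L[ℂ] H)} (h : I ≤ J) :
    amInfClosure I ≤ amInfClosure J :=
  preAmInf_mono (amInf_mono h)

variable [CompleteSpace H]

/-- The defining set is hereditary and stable under sums up to ampliation, so generating an ideal
adds no new sequences. -/
theorem mem_charSet_amInf_iff (hH : ¬ FiniteDimensional ℂ H) {I : TwoSidedIdeal (H →L[ℂ] H)}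
    {ξ : ℕ → ℝ} : ξ ∈ charSet (amInf I) ↔ ξ ∈ cZeroStar ∧
      ∃ η ∈ charSet (I ⊓ traceClass H), ∃ M : ℝ, ∀ k, ξ k ≤ M * amInfSeq η k := by
  constructor
  · rintro ⟨X, hX, -, rfl⟩
    refine (sNumbers_mem_of_mem_idealOf hH ?_ ?_ ?_ hX).2
    · exact ⟨zero_mem_cZeroStar, 0, ⟨0, TwoSidedIdeal.zero_mem _, isCompactOperator_zero,
        sNumbers_zero⟩, 0, by simp⟩
    · rintro ξ hξ η ⟨hη, ζ, hζ, M, hM⟩ C h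
      refine ⟨hξ, ζ, hζ, |C| * M, fun k => (h k).trans ?_⟩
      rw [mul_assoc]
      exact mul_le_mul (le_abs_self C) (hM k) (cZeroStar_nonneg hη k) (abs_nonneg C)
    · rintro ξ ⟨hξ, α, hα, M, hM⟩ η ⟨hη, β, hβ, N, hN⟩
      -- `M` and `N` may be negative, hence the maximum with `0`.
      refine ⟨_, ⟨cZeroStar_half (cZeroStar_add hξ hη), _, charSet_half hH
        (by simpa only [sup_idem] using charSet_add hH hα hβ), max (max M N) 0,
        fun k => ?_⟩, fun k => le_rfl⟩
      have hα' := lOneStar_of_mem_charSet hH hα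
      have hβ' := lOneStar_of_mem_charSet hH hβ
      have hle : ξ (k / 2) + η (k / 2) ≤ max (max M N) 0 *
          amInfSeq (fun n => α n + β n) (k / 2) := by
        rw [amInfSeq_add hα' hβ', mul_add]
        refine add_le_add ((hM _).trans ?_) ((hN _).trans ?_)
        · exact mul_le_mul_of_nonneg_right ((le_max_left _ _).trans (le_max_left _ _))
            (amInfSeq_nonneg hα' _)
        · exact mul_le_mul_of_nonneg_right ((le_max_right _ _).trans (le_max_left _ _))
            (amInfSeq_nonneg hβ' _)
      exact hle.trans (mul_le_mul_of_nonneg_left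
        (amInfSeq_le_amInfSeq_half (lOneStar_add hα' hβ') k) (le_max_right _ _))
  · exact fun h => mem_charSet_idealOf hH h.1 h

omit [CompleteSpace H] in
theorem mem_charSet_inf_traceClass {I : TwoSidedIdeal (H →L[ℂ] H)}
    {ξ : ℕ → ℝ} (hξ : ξ ∈ charSet I) (h : ξ ∈ lOneStar) : ξ ∈ charSet (I ⊓ traceClass H) := by
  obtain ⟨X, hX, hc, rfl⟩ := hξ
  exact ⟨X, (TwoSidedIdeal.mem_inf _).2 ⟨hX, mem_idealOf_of_sNumbers_mem hc h⟩, hc, rfl⟩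

theorem single_mem_charSet (hH : ¬ FiniteDimensional ℂ H) {I : TwoSidedIdeal (H →L[ℂ] H)}
    (hI : I ≠ ⊥) : (Pi.single 0 1 : ℕ → ℝ) ∈ charSet I := by
  obtain ⟨X, hX, hX0⟩ : ∃ X ∈ I, X ≠ 0 := by
    by_contra! h
    exact hI (le_bot_iff.1 fun X hX => (TwoSidedIdeal.mem_bot _).2 (h X hX))
  obtain ⟨v, hv⟩ : ∃ v, X v ≠ 0 := by
    by_contra! h
    exact hX0 (ContinuousLinearMap.ext h)
  obtain ⟨f, hf⟩ := exists_orthonormal_nat hH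
  have hc : (Pi.single 0 1 : ℕ → ℝ) ∈ cZeroStar := by
    constructor
    · intro m n h
      rcases Nat.eq_zero_or_pos m with rfl | hm
      · rcases Nat.eq_zero_or_pos n with rfl | hn <;> simp [*, Nat.pos_iff_ne_zero.1]
      · simp [hm.ne', (hm.trans_le h).ne']
    · refine tendsto_const_nhds.congr' ?_
      filter_upwards [Filter.eventually_gt_atTop 0] with n hn
      simp [hn.ne']
  have hb := isBddSeq_of_mem_cZeroStar hc
  rw [mem_charSet_iff hH hf hc hb]
  -- `B X A` carries `f 0` to `v`, then to `X v`, then back to `‖X v‖ ^ 2 • f 0`: a multiple of the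
  -- projection onto `f 0`.
  let A : H →L[ℂ] H := (innerSL ℂ (f 0)).smulRight v
  let B : H →L[ℂ] H := (innerSL ℂ (X v)).smulRight (f 0)
  have hmem : ((‖X v‖ : ℂ) ^ 2)⁻¹ • (B * (X * A)) ∈ I :=
    smul_mem _ (I.mul_mem_left _ _ (I.mul_mem_right _ _ hX))
  convert hmem using 1
  refine ContinuousLinearMap.ext fun w => ?_
  have h1 : diagOp hf hf hb w = ⟪f 0, w⟫_ℂ • f 0 := by
    refine (hasSum_diagOp hf hf hb w).unique ?_
    simpa using hasSum_single (f := fun n => (((Pi.single 0 1 : ℕ → ℝ) n : ℂ) * ⟪f n, w⟫_ℂ) • f n) 0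
      fun n hn => by simp [hn]
  have h2 : (B * (X * A)) w = ((‖X v‖ : ℂ) ^ 2 * ⟪f 0, w⟫_ℂ) • f 0 := by
    change ⟪X v, X (⟪f 0, w⟫_ℂ • v)⟫_ℂ • f 0 = _
    rw [map_smul, inner_smul_right, inner_self_eq_norm_sq_to_K, mul_comm]
    rfl
  have h3 : (‖X v‖ : ℂ) ^ 2 ≠ 0 := by simpa using hv
  rw [_root_.smul_apply, h1, h2, smul_smul, inv_mul_cancel_left₀ h3]

/-- This keeps `preAmInf` out of its conventional branch. The witness is `(1, 1, 0, …)`, since `(1,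
0, 0, …)` has zero mean at infinity. -/
theorem amInf_ne_bot (hH : ¬ FiniteDimensional ℂ H) {I : TwoSidedIdeal (H →L[ℂ] H)}
    (hI : I ≠ ⊥) : amInf I ≠ ⊥ := by
  intro hbot
  have h1 := charSet_half hH (single_mem_charSet hH hI)
  set ζ : ℕ → ℝ := fun k => (Pi.single 0 1 : ℕ → ℝ) (k / 2)
  have h2 : ζ ∈ lOneStar := by
    refine ⟨cZeroStar_of_mem_charSet hH h1, summable_of_ne_finset_zero (s := Finset.range 2) ?_⟩
    intro n hn
    have : n / 2 ≠ 0 := by rw [Finset.mem_range] at hn; omega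
    simp [ζ, this]
  have h3 : amInfSeq ζ ∈ charSet (amInf I) := (mem_charSet_amInf_iff hH).2
    ⟨amInfSeq_mem_cZeroStar h2, ζ, mem_charSet_inf_traceClass h1 h2, 1, by simp⟩
  obtain ⟨X, hX, -, hs⟩ := h3
  rw [hbot, TwoSidedIdeal.mem_bot] at hX
  rw [hX, sNumbers_zero] at hs
  have h4 := congrFun hs 0
  have h5 := sum_add_tail h2 1 1
  have h6 : ζ 1 = 1 := by simp [ζ]
  have h7 := tail_nonneg h2 2
  rw [amInfSeq_eq] at h4
  simp [h6] at h4 h5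
  linarith

theorem amInfClosure_sup_le (hH : ¬ FiniteDimensional ℂ H) (I J : TwoSidedIdeal (H →L[ℂ] H)) :
    amInfClosure (I ⊔ J) ≤ amInfClosure I ⊔ amInfClosure J := by
  rcases eq_or_ne I ⊥ with rfl | hI
  · rw [bot_sup_eq]; exact le_sup_right
  rcases eq_or_ne J ⊥ with rfl | hJ
  · rw [sup_bot_eq]; exact le_sup_left
  have hIJ : I ⊔ J ≠ ⊥ := fun h => hI (le_bot_iff.1 (le_sup_left.trans h.le))
  -- The right side is an ideal, so it suffices to treat generators, for which the condition on `ξ`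
  -- is available directly.
  rw [amInfClosure, preAmInf_of_ne_bot (amInf_ne_bot hH hIJ), idealOf, TwoSidedIdeal.span_le]
  rintro X ⟨hX, hξ, hcs⟩
  obtain ⟨-, η, hη, M, hM⟩ := (mem_charSet_amInf_iff hH).1 hcs
  obtain ⟨α, hα, β, hβ, hle⟩ :=
    exists_charSet_inf_of_mem_sup_inf hH (fun X hX => (mem_traceClass hH hX).1) hη
  have hη' := lOneStar_of_mem_charSet hH hη
  have hα' := lOneStar_of_mem_charSet hH hα
  have hβ' := lOneStar_of_mem_charSet hH hβ
  obtain ⟨ξ₁, h1, ξ₂, h2, hsum, hA, hB⟩ :=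
    exists_le_add_of_amInfSeq_le hξ hα' hβ' (abs_nonneg M) fun k => by
      rw [← amInfSeq_add hα' hβ']
      exact (hM k).trans (mul_le_mul (le_abs_self M)
        (amInfSeq_mono hη' (lOneStar_add hα' hβ') hle k) (amInfSeq_nonneg hη' k) (abs_nonneg M))
  have hmem : ∀ {K : TwoSidedIdeal (H →L[ℂ] H)} {ζ γ : ℕ → ℝ}, K ≠ ⊥ → ζ ∈ lOneStar →
      γ ∈ charSet (K ⊓ traceClass H) →
      (∀ k, amInfSeq ζ k ≤ 2 * |M| * amInfSeq (fun n => γ (n / 2)) k) →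
      ζ ∈ charSet (amInfClosure K) := by
    intro K ζ γ hK hζ hγ h
    rw [amInfClosure, preAmInf_of_ne_bot (amInf_ne_bot hH hK)]
    exact mem_charSet_idealOf hH hζ.1 ⟨hζ, (mem_charSet_amInf_iff hH).2
      ⟨amInfSeq_mem_cZeroStar hζ, _, charSet_half hH hγ, _, h⟩⟩
  exact (sNumbers_mem_charSet_iff hH hX).1 (charSet_of_le hH (C := 1) hξ.1
    (charSet_add hH (hmem hI h1 hα hA) (hmem hJ h2 hβ hB)) (by simpa using hsum))

end AmInfClosure

end OperatorIdeal

end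

theorem theorem3p2 {H : Type*} [NormedAddCommGroup H] [InnerProductSpace ℂ H] [CompleteSpace H]
    [TopologicalSpace.SeparableSpace H] (hH : ¬ FiniteDimensional ℂ H) :
    (∀ I J : TwoSidedIdeal (H →L[ℂ] H),
      OperatorIdeal.amInfClosure (I ⊔ J) =
        OperatorIdeal.amInfClosure I ⊔ OperatorIdeal.amInfClosure J) ∧
    (∀ I J : TwoSidedIdeal (H →L[ℂ] H),
      OperatorIdeal.IsAmInfClosed I → OperatorIdeal.IsAmInfClosed J →
        OperatorIdeal.IsAmInfClosed (I ⊔ J)) := by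
  have h : ∀ I J : TwoSidedIdeal (H →L[ℂ] H), OperatorIdeal.amInfClosure (I ⊔ J) =
      OperatorIdeal.amInfClosure I ⊔ OperatorIdeal.amInfClosure J := fun I J =>
    le_antisymm (OperatorIdeal.amInfClosure_sup_le hH I J)
      (sup_le (OperatorIdeal.amInfClosure_mono le_sup_left)
        (OperatorIdeal.amInfClosure_mono le_sup_right))
  refine ⟨h, fun I J hI hJ => ?_⟩
  rw [OperatorIdeal.IsAmInfClosed, h, ← hI, ← hJ]
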